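/- Let $\mathbb{T}=\mathbb{R}/2\pi\mathbb{Z}$ with normalized Haar measure $m$, and let $(n_j)_{j\ge 1}$ be a sequence of positive integers such that $n_{j+1}/n_j\ge 3$ for all $j\ge 1$ and $\sum_{j\ge 1}\left(\frac{n_j}{n_{j+1}}\right)^2<\infty$ (Schneider's condition). Define the Riesz products $R_0\equiv 1$ and $R_N(t)=\prod_{j=1}^N(1+\cos(n_jt))$ for $N\ge 1$. Then for every real $p\ge 1$ there are positive constants $c_p,C_p$ (depending only on $p$ and the fixed sequence $(n_j)$, and in particular neither on $N$, nor on the normed space, nor on the vectors) such that for every real normed space $(E,\|\cdot\|)$, all vectors $v_0,v_1,\ldots\in E$ and all $N\ge 1$, $$c_p\sum_{k=0}^N\|v_k\|^p\int_{\mathbb{T}}R_k^p\,\mathrm{d}m\ \le\ \int_{\mathbb{T}}\Big\|\sum_{k=0}^Nv_kR_k\Big\|^p\,\mathrm{d}m\ \le\ C_p\sum_{k=0}^N\|v_k\|^p\int_{\mathbb{T}}R_k^p\,\mathrm{d}m .$$ -/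

import Mathlib

open MeasureTheory

universe u

/-- The function `t ↦ cos t` on the torus `𝕋 = ℝ / 2πℤ`. -/
noncomputable def torusCos : AddCircle (2 * Real.pi) → ℝ :=
  Real.cos_periodic.lift

/-- The Riesz product `R_N(t) = ∏_{j=1}^N (1 + cos (n_j t))` on the torus, with `R_0 = 1`.
The frequencies are `n 1, n 2, …`; the value `n 0` is never used. -/
noncomputable def rieszProduct (n : ℕ → ℕ) (N : ℕ) (t : AddCircle (2 * Real.pi)) : ℝ :=
  ∏ j ∈ Finset.Icc 1 N, (1 + torusCos (n j • t))

/-- The integral over the torus against the normalized Haar measure `m`. -/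
noncomputable def torusMean (f : AddCircle (2 * Real.pi) → ℝ) : ℝ :=
  haveI : Fact (0 < 2 * Real.pi) := ⟨Real.two_pi_pos⟩
  ∫ t, f t ∂(AddCircle.haarAddCircle : Measure (AddCircle (2 * Real.pi)))

/-!
The idea is to compare the Riesz products with products of independent copies of `1 + cos`.

*Independent model.* `indepMoment` is the `p`-th moment of `‖y + r ∑ X₁ ⋯ X_l v_l‖` with independent
`X_i` distributed as `1 + cos`, written as an iterated integral, and `A = factorMoment p` is
`∫ (1 + cos) ^ p`. The upper bound (`exists_indepMoment_upper`) follows from a potential that adds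
to the `p`-th powers the mixed terms `‖y‖ ^ (p - 1) ‖v_l‖`; these are summable since the mean of
`X_i` is `1 < A` when `p > 1`. The lower bound (`exists_indepMoment_lower`) is an induction on the
number of terms, with coefficients that decrease geometrically. If the random terms outweigh the
constant term `y`, the decrease of the coefficients pays for `y`, because a random multiple of a
vector cannot be cancelled by a constant. Otherwise one uses that `∫ √(1 + cos) < 1`: once a factor
is tiny, the products stay below a geometric sequence with positive probability
(`TrappedBound`), the sum then stays near `y`, and on that event the remaining terms have only a
small share of their moments.

*Transfer to the circle.* Let `a`, `b` be trigonometric polynomials of degree at most `δ m`. The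
translates `s ↦ a (t - s / m) + b (t - s / m) (1 + cos (m t)) w`, viewed as a curve in `L^p`, have
frequencies at most `δ`, and the norm of the curve is `2π`-periodic in `s`, since translating by
`s / m` turns it into a shift of the phase of `cos (m t)`. Bernstein's inequality for the second
derivative, obtained from the Fourier series of `x ^ 2`, then shows that the norm is constant up to
a factor `1 + O(δ ^ 2)` (`lowFreq_norm_le`). Averaging over the phase replaces `cos (m t)` by an
independent factor (`integral_indepMoment_transfer`). For Riesz products `δ` is of the order of
`n j / n (j + 1)`, so that Schneider's condition bounds the product of all these factors.

*The first few frequencies*, for which `δ` is not small, are not transferred at all: the first `J`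
Riesz products are kept on the circle, where they are linearly independent by biorthogonality with
differences of cosines (`exists_biorthogonal`), and the constants may depend on `J`. The same
two-sided bound for a single scalar coefficient identifies `∫ R_k ^ p` with `A ^ k` up to constants.
-/

/-! ### The circle and the Riesz factor -/

local notation "𝕋" => AddCircle (2 * Real.pi)

local instance fact_two_pi_pos : Fact (0 < 2 * Real.pi) := ⟨Real.two_pi_pos⟩

local notation "𝔪" => (AddCircle.haarAddCircle : Measure (AddCircle (2 * Real.pi)))

/-- The single factor `1 + cos t` of a Riesz product. -/
noncomputable def rieszFactor (t : 𝕋) : ℝ := 1 + torusCos t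

theorem torusCos_coe (x : ℝ) : torusCos (x : 𝕋) = Real.cos x := rfl

theorem continuous_torusCos : Continuous torusCos :=
  continuous_quot_lift _ Real.continuous_cos

theorem neg_one_le_torusCos (t : 𝕋) : -1 ≤ torusCos t := by
  induction t using QuotientAddGroup.induction_on with
  | H x => exact Real.neg_one_le_cos x

theorem torusCos_le_one (t : 𝕋) : torusCos t ≤ 1 := by
  induction t using QuotientAddGroup.induction_on with
  | H x => exact Real.cos_le_one x

theorem abs_torusCos_le_one (t : 𝕋) : |torusCos t| ≤ 1 :=
  abs_le.2 ⟨neg_one_le_torusCos t, torusCos_le_one t⟩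

theorem torusCos_mul (s t : 𝕋) :
    torusCos s * torusCos t = (torusCos (s + t) + torusCos (s - t)) / 2 := by
  induction s using QuotientAddGroup.induction_on with
  | H x =>
    induction t using QuotientAddGroup.induction_on with
    | H y =>
      change Real.cos x * Real.cos y = (Real.cos (x + y) + Real.cos (x - y)) / 2
      rw [Real.cos_add, Real.cos_sub]; ring

theorem torusCos_sub_coe (t : 𝕋) (y : ℝ) :
    torusCos (t - (y : 𝕋)) =
      Real.cos y * torusCos t + Real.cos (y - Real.pi / 2) * torusCos (t - (Real.pi / 2 : ℝ)) := by
  induction t using QuotientAddGroup.induction_on with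
  | H x =>
    change Real.cos (x - y) = Real.cos y * Real.cos x +
      Real.cos (y - Real.pi / 2) * Real.cos (x - Real.pi / 2)
    rw [Real.cos_sub_pi_div_two, Real.cos_sub_pi_div_two, Real.cos_sub]; ring

theorem torusCos_add_pi (t : 𝕋) : torusCos (t + (Real.pi : ℝ)) = -torusCos t := by
  induction t using QuotientAddGroup.induction_on with
  | H x => exact Real.cos_add_pi x

theorem continuous_rieszFactor : Continuous rieszFactor :=
  continuous_const.add continuous_torusCos

theorem rieszFactor_nonneg (t : 𝕋) : 0 ≤ rieszFactor t := by
  have := neg_one_le_torusCos t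
  unfold rieszFactor; linarith

theorem rieszFactor_le_two (t : 𝕋) : rieszFactor t ≤ 2 := by
  have := torusCos_le_one t
  unfold rieszFactor; linarith

theorem rieszFactor_pi : rieszFactor ((Real.pi : ℝ) : 𝕋) = 0 := by
  simp [rieszFactor, torusCos_coe]

theorem Continuous.integrable_circle {F : Type*} [NormedAddCommGroup F] {f : 𝕋 → F}
    (hf : Continuous f) : Integrable f 𝔪 :=
  hf.integrable_of_hasCompactSupport (HasCompactSupport.of_compactSpace f)

theorem integral_circle_pos {f : 𝕋 → ℝ} (hf : Continuous f) (h0 : ∀ t, 0 ≤ f t) {x : 𝕋}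
    (hx : f x ≠ 0) : 0 < ∫ t, f t ∂𝔪 :=
  integral_pos_of_integrable_nonneg_nonzero hf hf.integrable_circle h0 hx

/-- Translating by half a period of `torusCos (k • ·)` changes the sign of the integrand. -/
theorem integral_torusCos_zsmul_add {k : ℤ} (hk : k ≠ 0) (φ : 𝕋) :
    ∫ t, torusCos (k • t + φ) ∂𝔪 = 0 := by
  have h : ∀ t : 𝕋, torusCos (k • (t + ((Real.pi / k : ℝ) : 𝕋)) + φ) = -torusCos (k • t + φ) := by
    intro t
    have h1 : k • ((Real.pi / k : ℝ) : 𝕋) = ((Real.pi : ℝ) : 𝕋) := by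
      rw [← AddCircle.coe_zsmul, zsmul_eq_mul, mul_div_cancel₀]
      exact_mod_cast hk
    rw [smul_add, h1, add_right_comm, torusCos_add_pi]
  have h2 := integral_add_right_eq_self (μ := 𝔪) (fun t => torusCos (k • t + φ))
    ((Real.pi / k : ℝ) : 𝕋)
  simp only [h, integral_neg] at h2
  linarith

theorem integral_torusCos : ∫ t, torusCos t ∂𝔪 = 0 := by
  simpa using integral_torusCos_zsmul_add one_ne_zero 0

theorem integral_rieszFactor : ∫ t, rieszFactor t ∂𝔪 = 1 := by
  unfold rieszFactor
  rw [integral_add (integrable_const _) continuous_torusCos.integrable_circle, integral_torusCos]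
  simp

/-- The moment `∫ (1 + cos)^p`. -/
noncomputable def factorMoment (p : ℝ) : ℝ := ∫ t, rieszFactor t ^ p ∂𝔪

theorem continuous_rieszFactor_rpow {p : ℝ} (hp : 0 ≤ p) :
    Continuous fun t => rieszFactor t ^ p :=
  continuous_rieszFactor.rpow_const fun _ => Or.inr hp

theorem bernoulli_rieszFactor {p : ℝ} (hp : 1 ≤ p) (t : 𝕋) :
    0 ≤ rieszFactor t ^ p - (1 + p * torusCos t) := by
  have := one_add_mul_self_le_rpow_one_add (neg_one_le_torusCos t) hp
  unfold rieszFactor; linarith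

theorem integral_bernoulli_rieszFactor {p : ℝ} (hp : 1 ≤ p) :
    ∫ t, (rieszFactor t ^ p - (1 + p * torusCos t)) ∂𝔪 = factorMoment p - 1 := by
  have h1 : Integrable (fun t => 1 + p * torusCos t) 𝔪 :=
    (continuous_const.add (continuous_const.mul continuous_torusCos)).integrable_circle
  rw [integral_sub (continuous_rieszFactor_rpow (by linarith)).integrable_circle h1,
    integral_add (integrable_const _) (continuous_torusCos.integrable_circle.const_mul p),
    integral_const_mul, integral_torusCos]
  simp [factorMoment]

theorem one_le_factorMoment {p : ℝ} (hp : 1 ≤ p) : 1 ≤ factorMoment p := by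
  have h := integral_bernoulli_rieszFactor hp
  have := integral_nonneg (μ := 𝔪) (f := fun t => rieszFactor t ^ p - (1 + p * torusCos t))
    (bernoulli_rieszFactor hp)
  linarith

theorem one_lt_factorMoment {p : ℝ} (hp : 1 < p) : 1 < factorMoment p := by
  have h := integral_bernoulli_rieszFactor hp.le
  have hc := continuous_rieszFactor_rpow (p := p) (by linarith)
  have hc' := continuous_torusCos
  have := integral_circle_pos (f := fun t => rieszFactor t ^ p - (1 + p * torusCos t))
    (x := ((Real.pi : ℝ) : 𝕋)) (by fun_prop)
    (bernoulli_rieszFactor hp.le) (by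
      simp only [rieszFactor_pi, torusCos_coe, Real.cos_pi]
      rw [Real.zero_rpow (by linarith)]
      intro h; linarith)
  linarith

theorem factorMoment_one : factorMoment 1 = 1 := by
  simp [factorMoment, integral_rieszFactor]

theorem continuous_sqrt_rieszFactor : Continuous fun t => √(rieszFactor t) :=
  continuous_rieszFactor.sqrt

/-- The square-root moment is strictly below `1`: this is what makes Riesz products small with
large probability, although their means are `1`. -/
theorem integral_sqrt_rieszFactor_lt_one : ∫ t, √(rieszFactor t) ∂𝔪 < 1 := by
  have hc : Continuous fun t => (1 - √(rieszFactor t)) ^ 2 :=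
    (continuous_const.sub continuous_sqrt_rieszFactor).pow 2
  have h := integral_circle_pos (x := ((Real.pi : ℝ) : 𝕋)) hc (fun t => sq_nonneg _)
    (by simp [rieszFactor_pi])
  have h2 : ∀ t, (1 - √(rieszFactor t)) ^ 2 = 1 - 2 * √(rieszFactor t) + rieszFactor t := by
    intro t
    have := Real.sq_sqrt (rieszFactor_nonneg t)
    linear_combination this
  simp only [h2] at h
  have hi := continuous_sqrt_rieszFactor.integrable_circle.const_mul 2
  have hi' : Integrable (fun t => 1 - 2 * √(rieszFactor t)) 𝔪 := (integrable_const _).sub hi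
  rw [integral_add hi' continuous_rieszFactor.integrable_circle,
    integral_sub (integrable_const _) hi,
    integral_const_mul, integral_rieszFactor] at h
  simp at h
  linarith

theorem integral_abs_torusCos_rpow_pos {p : ℝ} (hp : 0 ≤ p) :
    0 < ∫ t, |torusCos t| ^ p ∂𝔪 :=
  integral_circle_pos (x := ((0 : ℝ) : 𝕋))
    (continuous_torusCos.abs.rpow_const fun _ => Or.inr hp)
    (fun t => by positivity) (by rw [torusCos_coe]; simp)

theorem integral_abs_torusCos_rpow_le_one {p : ℝ} (hp : 0 ≤ p) :
    ∫ t, |torusCos t| ^ p ∂𝔪 ≤ 1 := by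
  have : ∫ t, |torusCos t| ^ p ∂𝔪 ≤ ∫ _t, (1 : ℝ) ∂𝔪 :=
    integral_mono
      (continuous_torusCos.abs.rpow_const fun _ => Or.inr hp).integrable_circle
      (integrable_const _)
      fun t => Real.rpow_le_one (abs_nonneg _) (abs_torusCos_le_one t) hp
  simpa using this

theorem add_rpow_le_two_rpow_mul {p a b : ℝ} (hp : 1 ≤ p) (ha : 0 ≤ a) (hb : 0 ≤ b) :
    (a + b) ^ p ≤ 2 ^ (p - 1) * (a ^ p + b ^ p) := by
  lift a to NNReal using ha
  lift b to NNReal using hb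
  exact_mod_cast NNReal.rpow_add_le_mul_rpow_add_rpow a b hp

/-- Convexity of `x ↦ x ^ p` in the form `‖x - y‖ ^ p ≤ 2 ^ (p - 1) (‖x‖ ^ p + ‖y‖ ^ p)`. -/
theorem norm_sub_rpow_le {E : Type*} [SeminormedAddCommGroup E] {p : ℝ} (hp : 1 ≤ p) (x y : E) :
    ‖x - y‖ ^ p ≤ 2 ^ (p - 1) * (‖x‖ ^ p + ‖y‖ ^ p) :=
  (Real.rpow_le_rpow (norm_nonneg _) (norm_sub_le x y) (by linarith)).trans
    (add_rpow_le_two_rpow_mul hp (norm_nonneg x) (norm_nonneg y))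

variable {E : Type u} [NormedAddCommGroup E] [NormedSpace ℝ E]

/-- A random multiple `X • w` cannot be cancelled by a constant vector: pair `t` with `t + π`. -/
theorem le_integral_norm_add_rieszFactor_smul {p : ℝ} (hp : 1 ≤ p) (y w : E) :
    (∫ t, |torusCos t| ^ p ∂𝔪) * ‖w‖ ^ p ≤ ∫ t, ‖y + rieszFactor t • w‖ ^ p ∂𝔪 := by
  have hp0 : 0 ≤ p := by linarith
  set f : 𝕋 → ℝ := fun t => ‖y + rieszFactor t • w‖ ^ p with hf
  have hfc : Continuous f :=
    (continuous_const.add (continuous_rieszFactor.smul continuous_const)).norm.rpow_const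
      fun _ => Or.inr hp0
  have hfs : Continuous fun t => f (t + ((Real.pi : ℝ) : 𝕋)) :=
    hfc.comp (continuous_id.add continuous_const)
  have hpt : ∀ t, |torusCos t| ^ p * ‖w‖ ^ p ≤
      (1 / 2) * (f t + f (t + ((Real.pi : ℝ) : 𝕋))) := by
    intro t
    have h := norm_sub_rpow_le hp (y + rieszFactor t • w)
      (y + rieszFactor (t + ((Real.pi : ℝ) : 𝕋)) • w)
    have h1 : (y + rieszFactor t • w) - (y + rieszFactor (t + ((Real.pi : ℝ) : 𝕋)) • w)
        = (2 * torusCos t) • w := by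
      rw [add_sub_add_left_eq_sub, ← sub_smul]
      congr 1
      simp only [rieszFactor, torusCos_add_pi]; ring
    rw [h1, norm_smul, Real.norm_eq_abs, abs_mul, abs_two,
      Real.mul_rpow (by positivity) (norm_nonneg _), Real.mul_rpow (by norm_num) (abs_nonneg _),
      Real.rpow_sub_one two_ne_zero] at h
    have h2 : (0 : ℝ) < 2 ^ p := by positivity
    have h3 : 2 ^ p * (|torusCos t| ^ p * ‖w‖ ^ p) ≤
        2 ^ p * ((1 / 2) * (f t + f (t + ((Real.pi : ℝ) : 𝕋)))) := by
      simp only [hf]; linarith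
    exact le_of_mul_le_mul_left h3 h2
  calc (∫ t, |torusCos t| ^ p ∂𝔪) * ‖w‖ ^ p
      = ∫ t, |torusCos t| ^ p * ‖w‖ ^ p ∂𝔪 := (integral_mul_const _ _).symm
    _ ≤ ∫ t, (1 / 2) * (f t + f (t + ((Real.pi : ℝ) : 𝕋))) ∂𝔪 :=
        integral_mono
          ((continuous_torusCos.abs.rpow_const fun _ => Or.inr hp0).mul
            continuous_const).integrable_circle
          (continuous_const.mul (hfc.add hfs)).integrable_circle hpt
    _ = ∫ t, f t ∂𝔪 := by
        rw [integral_const_mul, integral_add hfc.integrable_circle hfs.integrable_circle,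
          integral_add_right_eq_self]
        ring

/-! ### Moments in the independent model -/

/-- `indepMoment p M v y r` is the `p`-th moment of the norm of
`y + r • (X₁ • v 0 + (X₁ X₂) • v 1 + ⋯ + (X₁ ⋯ X_M) • v (M - 1))`, where `X₁, …, X_M` are independent
copies of `1 + cos`; it is encoded as an iterated integral, one factor at a time. -/
noncomputable def indepMoment (p : ℝ) : ℕ → (ℕ → E) → E → ℝ → ℝ
  | 0, _, y, _ => ‖y‖ ^ p
  | M + 1, v, y, r => ∫ t, indepMoment p M (fun k => v (k + 1))
      (y + (r * rieszFactor t) • v 0) (r * rieszFactor t) ∂𝔪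

theorem indepMoment_zero (p : ℝ) (v : ℕ → E) (y : E) (r : ℝ) :
    indepMoment p 0 v y r = ‖y‖ ^ p := rfl

theorem indepMoment_succ (p : ℝ) (M : ℕ) (v : ℕ → E) (y : E) (r : ℝ) :
    indepMoment p (M + 1) v y r = ∫ t, indepMoment p M (fun k => v (k + 1))
      (y + (r * rieszFactor t) • v 0) (r * rieszFactor t) ∂𝔪 := rfl

/-- An integral over the circle depends continuously on parameters from any space, locally compact
or not. -/
theorem continuous_integral_circle {Y : Type*} [TopologicalSpace Y] {f : Y → 𝕋 → ℝ}
    (hf : Continuous fun q : Y × 𝕋 => f q.1 q.2) : Continuous fun y => ∫ t, f y t ∂𝔪 := by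
  let F : C(Y, C(𝕋, ℝ)) := ContinuousMap.curry ⟨fun q : Y × 𝕋 => f q.1 q.2, hf⟩
  have h : Continuous fun g : C(𝕋, ℝ) => ∫ t, g t ∂𝔪 := by
    refine LipschitzWith.continuous (K := 1) (LipschitzWith.of_dist_le_mul fun g g' => ?_)
    rw [Real.dist_eq, ← integral_sub g.continuous.integrable_circle g'.continuous.integrable_circle]
    have := norm_integral_le_of_norm_le_const (μ := 𝔪) (f := fun t => g t - g' t) (C := dist g g')
      (Filter.Eventually.of_forall fun t => by
        rw [← dist_eq_norm]; exact ContinuousMap.dist_apply_le_dist t)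
    simpa using this
  exact h.comp F.continuous

theorem continuous_indepMoment {p : ℝ} (hp : 0 ≤ p) (M : ℕ) (v : ℕ → E) :
    Continuous fun q : E × ℝ => indepMoment p M v q.1 q.2 := by
  induction M generalizing v with
  | zero => exact continuous_fst.norm.rpow_const fun _ => Or.inr hp
  | succ M ih =>
    refine continuous_integral_circle (Y := E × ℝ) (f := fun q t => indepMoment p M
      (fun k => v (k + 1)) (q.1 + (q.2 * rieszFactor t) • v 0) (q.2 * rieszFactor t)) ?_
    have := continuous_rieszFactor
    have h : Continuous fun q : (E × ℝ) × 𝕋 =>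
        (q.1.1 + (q.1.2 * rieszFactor q.2) • v 0, q.1.2 * rieszFactor q.2) := by fun_prop
    exact (ih fun k => v (k + 1)).comp h

theorem Continuous.indepMoment {Y : Type*} [TopologicalSpace Y] {p : ℝ} (hp : 0 ≤ p) (M : ℕ)
    (v : ℕ → E) {f : Y → E} {g : Y → ℝ} (hf : Continuous f) (hg : Continuous g) :
    Continuous fun y => indepMoment p M v (f y) (g y) :=
  (continuous_indepMoment hp M v).comp (hf.prodMk hg)

theorem indepMoment_nonneg (p : ℝ) (M : ℕ) (v : ℕ → E) (y : E) (r : ℝ) :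
    0 ≤ indepMoment p M v y r := by
  induction M generalizing v y r with
  | zero => exact Real.rpow_nonneg (norm_nonneg _) _
  | succ M ih => exact integral_nonneg fun t => ih _ _ _

/-! ### Lower bound in the independent model -/

/-- `E ‖(X₁ ⋯ X_{l+1}) • v l‖ ^ p` for independent factors. -/
noncomputable def weight {F : Type*} [NormedAddCommGroup F] (p : ℝ) (v : ℕ → F) (l : ℕ) : ℝ :=
  factorMoment p ^ (l + 1) * ‖v l‖ ^ p

theorem factorMoment_pos {p : ℝ} (hp : 1 ≤ p) : 0 < factorMoment p :=
  zero_lt_one.trans_le (one_le_factorMoment hp)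

theorem weight_nonneg {F : Type*} [NormedAddCommGroup F] {p : ℝ} (hp : 1 ≤ p)
    (v : ℕ → F) (l : ℕ) : 0 ≤ weight p v l := by
  have := factorMoment_pos hp
  unfold weight; positivity

theorem norm_rpow_le_weight {F : Type*} [NormedAddCommGroup F] {p : ℝ} (hp : 1 ≤ p)
    (v : ℕ → F) (l : ℕ) :
    ‖v l‖ ^ p ≤ weight p v l :=
  le_mul_of_one_le_left (by positivity) (one_le_pow₀ (one_le_factorMoment hp))

theorem factorMoment_mul_weight_shift {F : Type*} [NormedAddCommGroup F] (p : ℝ) (v : ℕ → F)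
    (l : ℕ) :
    factorMoment p * weight p (fun k => v (k + 1)) l = weight p v (l + 1) := by
  unfold weight; ring

/-- Coefficients decreasing geometrically from `b` to `b / 2`. -/
noncomputable def decayCoeff (b lam : ℝ) (l : ℕ) : ℝ := b / 2 * (1 + lam ^ l)

theorem decayCoeff_succ_le {b lam : ℝ} (hb : 0 ≤ b) (h0 : 0 ≤ lam) (l : ℕ) :
    decayCoeff b lam (l + 1) + b / 2 * (1 - lam) * lam ^ (l + 1) ≤ decayCoeff b lam l := by
  have h : decayCoeff b lam l - (decayCoeff b lam (l + 1) + b / 2 * (1 - lam) * lam ^ (l + 1)) =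
      b / 2 * lam ^ l * (1 - lam) ^ 2 := by unfold decayCoeff; ring
  have : 0 ≤ b / 2 * lam ^ l * (1 - lam) ^ 2 := by positivity
  linarith

theorem decayCoeff_anti {b lam : ℝ} (hb : 0 ≤ b) (h0 : 0 ≤ lam) (h1 : lam ≤ 1) (l : ℕ) :
    decayCoeff b lam (l + 1) ≤ decayCoeff b lam l := by
  have h := decayCoeff_succ_le hb h0 l
  have : 0 ≤ b / 2 * (1 - lam) * lam ^ (l + 1) := by
    have : 0 ≤ 1 - lam := by linarith
    positivity
  linarith

theorem half_le_decayCoeff {b lam : ℝ} (hb : 0 ≤ b) (h0 : 0 ≤ lam) (l : ℕ) :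
    b / 2 ≤ decayCoeff b lam l := by
  have : 0 ≤ b / 2 * lam ^ l := by positivity
  unfold decayCoeff; linarith

theorem decayCoeff_zero (b lam : ℝ) : decayCoeff b lam 0 = b := by
  unfold decayCoeff; norm_num

variable (E) in
/-- The lower bound for sums with `M` random terms. -/
def LowerBound (p a b lam : ℝ) (M : ℕ) : Prop :=
  ∀ (v : ℕ → E) (y : E) (r : ℝ), 0 ≤ r →
    a * ‖y‖ ^ p + r ^ p * ∑ l ∈ Finset.range M, decayCoeff b lam l * weight p v l
      ≤ indepMoment p M v y r

variable (E) in
/-- The lower bound for sums whose constant term `y` exceeds by `D` everything the random terms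
contribute as long as the `l`-th partial product stays below `e * (lam ^ 2) ^ l`. The factor
`1 - κ √(r / e)` bounds from below the probability that it does so forever. -/
def TrappedBound (p b lam κ : ℝ) (M : ℕ) : Prop :=
  ∀ (v : ℕ → E) (y : E) (r e D : ℝ), 0 ≤ r → r ≤ e → 0 ≤ D →
    D + ∑ l ∈ Finset.range M, e * (lam ^ 2) ^ (l + 1) * ‖v l‖ ≤ ‖y‖ →
    D ^ p * (1 - κ * √(r / e)) + r ^ p * ∑ l ∈ Finset.range M, decayCoeff b lam l * weight p v l
        - b * factorMoment p * ∑ l ∈ Finset.range M, (e * (lam ^ 2) ^ l) ^ p * ‖v l‖ ^ p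
      ≤ indepMoment p M v y r

theorem trappedBound_zero {p b lam κ : ℝ} (hp : 1 ≤ p) (hκ : 0 ≤ κ) :
    TrappedBound E p b lam κ 0 := by
  intro v y r e D hr hre hD hy
  simp only [Finset.range_zero, Finset.sum_empty, add_zero, mul_zero, sub_zero] at hy ⊢
  have h1 : D ^ p ≤ ‖y‖ ^ p := Real.rpow_le_rpow hD hy (by linarith)
  have h2 : 0 ≤ D ^ p * (κ * √(r / e)) := by positivity
  rw [indepMoment_zero]
  linarith

theorem sum_decayCoeff_weight_succ_le {F : Type*} [NormedAddCommGroup F] {p b lam : ℝ}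
    (hp : 1 ≤ p) (hb : 0 ≤ b) (h0 : 0 ≤ lam)
    (h1 : lam ≤ 1) (M : ℕ) (v : ℕ → F) :
    ∑ l ∈ Finset.range (M + 1), decayCoeff b lam l * weight p v l ≤
      factorMoment p * (∑ l ∈ Finset.range M, decayCoeff b lam l * weight p (fun k => v (k + 1)) l)
        + b * factorMoment p * ‖v 0‖ ^ p := by
  rw [Finset.sum_range_succ', decayCoeff_zero, Finset.mul_sum]
  refine add_le_add (Finset.sum_le_sum fun l _ => ?_) (le_of_eq ?_)
  · rw [mul_left_comm, factorMoment_mul_weight_shift]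
    exact mul_le_mul_of_nonneg_right (decayCoeff_anti hb h0 h1 l) (weight_nonneg hp v _)
  · simp only [weight]; ring

theorem integral_mul_rieszFactor_rpow {p r : ℝ} (hr : 0 ≤ r) (S : ℝ) :
    ∫ t, (r * rieszFactor t) ^ p * S ∂𝔪 = r ^ p * (factorMoment p * S) := by
  simp_rw [Real.mul_rpow hr (rieszFactor_nonneg _)]
  rw [integral_mul_const, integral_const_mul, factorMoment]; ring

theorem continuous_mul_rieszFactor_rpow {p : ℝ} (hp : 1 ≤ p) (r S : ℝ) :
    Continuous fun t => (r * rieszFactor t) ^ p * S :=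
  ((continuous_const.mul continuous_rieszFactor).rpow_const
    fun _ => Or.inr (by linarith)).mul continuous_const

theorem continuous_indepMoment_step {p : ℝ} (hp : 1 ≤ p) (M : ℕ) (v : ℕ → E) (y w : E) (r : ℝ) :
    Continuous fun t => indepMoment p M v (y + (r * rieszFactor t) • w) (r * rieszFactor t) := by
  have := continuous_rieszFactor
  exact Continuous.indepMoment (by linarith) M v (by fun_prop) (by fun_prop)

theorem trappedBound_succ {p a b lam κ : ℝ} {M : ℕ} (hp : 1 ≤ p) (ha : 0 ≤ a) (hb : 0 ≤ b)
    (h0 : 0 < lam) (h1 : lam ≤ 1) (hκ : (κ + 1) * ∫ t, √(rieszFactor t) ∂𝔪 = κ * lam)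
    (hκ0 : 0 ≤ κ) (hL : LowerBound E p a b lam M) (hT : TrappedBound E p b lam κ M) :
    TrappedBound E p b lam κ (M + 1) := by
  intro v y r e D hr hre hD hy
  have he : 0 ≤ e := hr.trans hre
  have hA := factorMoment_pos hp
  set S := ∑ l ∈ Finset.range M, decayCoeff b lam l * weight p (fun k => v (k + 1)) l with hS
  set Q := ∑ l ∈ Finset.range M, (e * (lam ^ 2) ^ (l + 1)) ^ p * ‖v (l + 1)‖ ^ p with hQ
  have hQ0 : 0 ≤ Q := Finset.sum_nonneg fun l _ => by positivity
  have hsq : ∀ t, √(r * rieszFactor t / (e * lam ^ 2)) = √(r / e) / lam * √(rieszFactor t) := by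
    intro t
    rw [← Real.sqrt_sq h0.le, ← Real.sqrt_div (by positivity), ← Real.sqrt_mul (by positivity),
      Real.sqrt_sq h0.le]
    congr 1
    rw [div_div, mul_comm (r / _), mul_comm r, mul_div_assoc]
  -- the pointwise bound: `TrappedBound` while the product is small, `LowerBound` otherwise
  have hpt : ∀ t, D ^ p * (1 - (κ + 1) * (√(r / e) / lam * √(rieszFactor t)))
      + (r * rieszFactor t) ^ p * S - b * factorMoment p * Q ≤
      indepMoment p M (fun k => v (k + 1)) (y + (r * rieszFactor t) • v 0) (r * rieszFactor t) := by
    intro t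
    have hX := rieszFactor_nonneg t
    have hrX : 0 ≤ r * rieszFactor t := mul_nonneg hr hX
    rw [← hsq t]
    by_cases hal : r * rieszFactor t ≤ e * lam ^ 2
    · have hy' : D + ∑ l ∈ Finset.range M, e * lam ^ 2 * (lam ^ 2) ^ (l + 1) * ‖v (l + 1)‖ ≤
          ‖y + (r * rieszFactor t) • v 0‖ := by
        rw [Finset.sum_range_succ'] at hy
        have h2 : ‖y‖ ≤ ‖y + (r * rieszFactor t) • v 0‖ + r * rieszFactor t * ‖v 0‖ := by
          have := norm_sub_le (y + (r * rieszFactor t) • v 0) ((r * rieszFactor t) • v 0)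
          rwa [add_sub_cancel_right, norm_smul, Real.norm_of_nonneg hrX] at this
        have h3 : r * rieszFactor t * ‖v 0‖ ≤ e * lam ^ 2 * ‖v 0‖ := by gcongr
        have h4 : ∑ l ∈ Finset.range M, e * lam ^ 2 * (lam ^ 2) ^ (l + 1) * ‖v (l + 1)‖ =
            ∑ l ∈ Finset.range M, e * (lam ^ 2) ^ (l + 1 + 1) * ‖v (l + 1)‖ :=
          Finset.sum_congr rfl fun l _ => by ring
        rw [h4]
        simp only [zero_add, pow_one] at hy
        linarith
      have h5 := hT (fun k => v (k + 1)) _ _ (e * lam ^ 2) D hrX hal hD hy'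
      have h6 : ∑ l ∈ Finset.range M, (e * lam ^ 2 * (lam ^ 2) ^ l) ^ p * ‖v (l + 1)‖ ^ p = Q :=
        Finset.sum_congr rfl fun l _ => by rw [pow_succ' (lam ^ 2) l, mul_assoc]
      rw [h6] at h5
      have h7 : 0 ≤ D ^ p * √(r * rieszFactor t / (e * lam ^ 2)) := by positivity
      linarith
    · push Not at hal
      have h5 := hL (fun k => v (k + 1)) (y + (r * rieszFactor t) • v 0) _ hrX
      have h6 : 1 ≤ √(r * rieszFactor t / (e * lam ^ 2)) := by
        have he' : 0 < e := by
          rcases he.eq_or_lt with h | h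
          · exfalso
            have : r = 0 := le_antisymm (hre.trans h.symm.le) hr
            simp [this, ← h] at hal
          · exact h
        rw [Real.one_le_sqrt, le_div_iff₀ (by positivity)]
        linarith
      have h7 : D ^ p * (1 - (κ + 1) * √(r * rieszFactor t / (e * lam ^ 2))) ≤ 0 := by
        refine mul_nonpos_of_nonneg_of_nonpos (by positivity) ?_
        nlinarith
      have h8 : 0 ≤ b * factorMoment p * Q := by positivity
      have h9 : 0 ≤ a * ‖y + (r * rieszFactor t) • v 0‖ ^ p := by positivity
      linarith
  have hc1 := continuous_sqrt_rieszFactor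
  have hc2 := continuous_mul_rieszFactor_rpow hp r S
  have hint : ∫ t, (D ^ p * (1 - (κ + 1) * (√(r / e) / lam * √(rieszFactor t)))
      + (r * rieszFactor t) ^ p * S - b * factorMoment p * Q) ∂𝔪 =
      D ^ p * (1 - κ * √(r / e)) + r ^ p * (factorMoment p * S) - b * factorMoment p * Q := by
    have i1 : Integrable (fun t => D ^ p * (1 - (κ + 1) * (√(r / e) / lam * √(rieszFactor t)))) 𝔪 :=
      Continuous.integrable_circle (by fun_prop)
    have i2 := hc2.integrable_circle
    have i3 : Integrable (fun t => D ^ p * (1 - (κ + 1) * (√(r / e) / lam * √(rieszFactor t)))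
        + (r * rieszFactor t) ^ p * S) 𝔪 := i1.add i2
    rw [integral_sub i3 (integrable_const _), integral_add i1 i2,
      integral_mul_rieszFactor_rpow hr, integral_const_mul, integral_sub (integrable_const _)
        (Continuous.integrable_circle (by fun_prop)), integral_const_mul, integral_const_mul]
    simp only [integral_const, probReal_univ, smul_eq_mul, one_mul]
    have : (κ + 1) * (√(r / e) / lam * ∫ t, √(rieszFactor t) ∂𝔪) = κ * √(r / e) := by
      rw [show (κ + 1) * (√(r / e) / lam * ∫ t, √(rieszFactor t) ∂𝔪) =
        ((κ + 1) * ∫ t, √(rieszFactor t) ∂𝔪) * (√(r / e) / lam) by ring, hκ]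
      field_simp
    rw [this]
  have hmono := integral_mono (μ := 𝔪) (Continuous.integrable_circle (by fun_prop))
    (continuous_indepMoment_step hp M (fun k => v (k + 1)) y (v 0) r).integrable_circle hpt
  rw [hint, ← indepMoment_succ] at hmono
  have hs := sum_decayCoeff_weight_succ_le hp hb h0.le h1 M v
  have hrp : 0 ≤ r ^ p := by positivity
  have hre' : r ^ p ≤ e ^ p := Real.rpow_le_rpow hr hre (by linarith)
  have hs' := mul_le_mul_of_nonneg_left hs hrp
  have hb' : r ^ p * (b * factorMoment p * ‖v 0‖ ^ p) ≤ e ^ p * (b * factorMoment p * ‖v 0‖ ^ p) :=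
    mul_le_mul_of_nonneg_right hre' (by positivity)
  rw [Finset.sum_range_succ' (fun l => (e * (lam ^ 2) ^ l) ^ p * ‖v l‖ ^ p), ← hQ, pow_zero, mul_one]
  linarith

theorem lowerBound_zero {p a b lam : ℝ} (ha : a ≤ 1) : LowerBound E p a b lam 0 := by
  intro v y r _
  simp only [Finset.range_zero, Finset.sum_empty, mul_zero, add_zero, indepMoment_zero]
  exact mul_le_of_le_one_left (by positivity) ha

theorem sum_pow_le_inv_one_sub {x : ℝ} (h0 : 0 ≤ x) (h1 : x < 1) (M : ℕ) :
    ∑ l ∈ Finset.range M, x ^ l ≤ (1 - x)⁻¹ := by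
  rw [← tsum_geometric_of_lt_one h0 h1]
  exact (summable_geometric_of_lt_one h0 h1).sum_le_tsum _ fun l _ => by positivity

/-- The inductive step when the random terms outweigh the constant term `y`: the decrease of the
coefficients pays for `y`. -/
theorem lowerBound_succ_of_le {p a b lam : ℝ} {M : ℕ} (hp : 1 ≤ p) (ha : 0 ≤ a) (hb : 0 ≤ b)
    (h0 : 0 < lam) (hab : 2 * b * factorMoment p ≤ a * ∫ t, |torusCos t| ^ p ∂𝔪)
    (hL : LowerBound E p a b lam M) (v : ℕ → E) (y : E) {r : ℝ} (hr : 0 ≤ r)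
    (hy : a * ‖y‖ ^ p ≤ b / 2 * (1 - lam) *
      (r ^ p * ∑ l ∈ Finset.range (M + 1), lam ^ l * weight p v l)) :
    a * ‖y‖ ^ p + r ^ p * ∑ l ∈ Finset.range (M + 1), decayCoeff b lam l * weight p v l
      ≤ indepMoment p (M + 1) v y r := by
  set S := ∑ l ∈ Finset.range M, decayCoeff b lam l * weight p (fun k => v (k + 1)) l with hS
  have hrp : 0 ≤ r ^ p := by positivity
  have hw0 : 0 ≤ r ^ p * weight p v 0 := mul_nonneg hrp (weight_nonneg hp v 0)
  have hc1 : Continuous fun t => ‖y + (r * rieszFactor t) • v 0‖ ^ p := by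
    have := continuous_rieszFactor
    exact Continuous.rpow_const (by fun_prop) fun _ => Or.inr (by linarith)
  have hc2 := continuous_mul_rieszFactor_rpow hp r S
  have hmono := integral_mono (μ := 𝔪) ((hc1.integrable_circle.const_mul a).add hc2.integrable_circle)
    (continuous_indepMoment_step hp M (fun k => v (k + 1)) y (v 0) r).integrable_circle
    (fun t => by
      have h := hL (fun k => v (k + 1)) (y + (r * rieszFactor t) • v 0) (r * rieszFactor t)
        (mul_nonneg hr (rieszFactor_nonneg t))
      exact h)
  rw [← indepMoment_succ] at hmono
  have hi : ∫ t, ((fun t => a * ‖y + (r * rieszFactor t) • v 0‖ ^ p) +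
      fun t => (r * rieszFactor t) ^ p * S) t ∂𝔪 =
      a * (∫ t, ‖y + (r * rieszFactor t) • v 0‖ ^ p ∂𝔪) + r ^ p * (factorMoment p * S) := by
    rw [integral_add' (hc1.integrable_circle.const_mul a) hc2.integrable_circle,
      integral_const_mul, integral_mul_rieszFactor_rpow hr]
  rw [hi] at hmono
  have hsm := le_integral_norm_add_rieszFactor_smul hp y (r • v 0)
  simp_rw [smul_smul, mul_comm (rieszFactor _) r] at hsm
  rw [norm_smul, Real.norm_of_nonneg hr, Real.mul_rpow hr (norm_nonneg _)] at hsm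
  have hsm' := mul_le_mul_of_nonneg_left hsm ha
  have hv : 2 * b * (r ^ p * weight p v 0) ≤
      a * ((∫ t, |torusCos t| ^ p ∂𝔪) * (r ^ p * ‖v 0‖ ^ p)) := by
    have := mul_le_mul_of_nonneg_right hab (by positivity : 0 ≤ r ^ p * ‖v 0‖ ^ p)
    simp only [weight, zero_add, pow_one]
    linarith
  have hsum : ∑ l ∈ Finset.range M, (decayCoeff b lam (l + 1) * weight p v (l + 1)
      + b / 2 * (1 - lam) * (lam ^ (l + 1) * weight p v (l + 1))) ≤ factorMoment p * S := by
    rw [hS, Finset.mul_sum]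
    refine Finset.sum_le_sum fun l _ => ?_
    rw [mul_left_comm (factorMoment p), factorMoment_mul_weight_shift]
    have := mul_le_mul_of_nonneg_right (decayCoeff_succ_le hb h0.le l)
      (weight_nonneg hp v (l + 1))
    linarith
  rw [Finset.sum_add_distrib, ← Finset.mul_sum] at hsum
  have hsum' := mul_le_mul_of_nonneg_left hsum hrp
  rw [Finset.sum_range_succ'] at hy ⊢
  rw [decayCoeff_zero]
  rw [pow_zero, one_mul] at hy
  have : 0 ≤ b * (r ^ p * weight p v 0) := by positivity
  have : 0 ≤ lam * (b * (r ^ p * weight p v 0)) := by positivity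
  linarith

/-- The inductive step when the constant term dominates the random terms with geometrically
decreasing weights: if the next factor is tiny, which happens with positive probability, the sum is
trapped near `y`. -/
theorem lowerBound_succ_of_ge {p a b lam κ Γ η ε : ℝ} {M : ℕ} (hp : 1 ≤ p) (ha : 0 ≤ a) (hb : 0 < b)
    (h0 : 0 < lam) (h1 : lam < 1) (hκ : 0 ≤ κ) (hΓ : 1 ≤ Γ) (haΓ : a ≤ Γ * (b / 2 * (1 - lam)))
    (hη : 0 < η) (hη1 : η ≤ 1) (hηΓ : η * Γ ≤ (1 - lam) / 2) (hε : 0 < ε) (hεη : ε ≤ η)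
    (hκε : κ * √(ε / η) ≤ 1 / 2)
    (hg : a + b * Γ ≤ (∫ t, max 0 (1 - rieszFactor t / ε) ∂𝔪) *
      ((2 ^ p)⁻¹ / 2 - b * factorMoment p * (Γ / lam * (1 - lam)⁻¹)))
    (hL : LowerBound E p a b lam M) (hT : TrappedBound E p b lam κ M)
    (v : ℕ → E) (y : E) {r : ℝ} (hr : 0 ≤ r)
    (hy : b / 2 * (1 - lam) *
      (r ^ p * ∑ l ∈ Finset.range (M + 1), lam ^ l * weight p v l) ≤ a * ‖y‖ ^ p) :
    a * ‖y‖ ^ p + r ^ p * ∑ l ∈ Finset.range (M + 1), decayCoeff b lam l * weight p v l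
      ≤ indepMoment p (M + 1) v y r := by
  have hA := factorMoment_pos hp
  have h1' : 0 < 1 - lam := by linarith
  have hp0 : 0 < p := by linarith
  set S := ∑ l ∈ Finset.range M, decayCoeff b lam l * weight p (fun k => v (k + 1)) l with hS
  set g := (2 ^ p)⁻¹ / 2 - b * factorMoment p * (Γ / lam * (1 - lam)⁻¹) with hg'
  have hφ : ∀ t, 0 ≤ max 0 (1 - rieszFactor t / ε) := fun t => le_max_left _ _
  have hφ0 : 0 ≤ ∫ t, max 0 (1 - rieszFactor t / ε) ∂𝔪 := integral_nonneg hφ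
  have hg0 : 0 < g := by
    by_contra! h
    have := mul_nonpos_of_nonneg_of_nonpos hφ0 h
    have : 0 < b * Γ := by positivity
    linarith
  have hrp : 0 ≤ r ^ p := by positivity
  have hyp : 0 ≤ ‖y‖ ^ p := by positivity
  -- each weighted term is dominated by `y`
  have hterm : ∀ l < M + 1, lam ^ l * (r ^ p * weight p v l) ≤ Γ * ‖y‖ ^ p := by
    intro l hl
    have hs := Finset.single_le_sum (f := fun l => lam ^ l * weight p v l)
      (fun l _ => mul_nonneg (by positivity) (weight_nonneg hp v l)) (Finset.mem_range.2 hl)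
    have hs' := mul_le_mul_of_nonneg_left hs hrp
    have hc : 0 < b / 2 * (1 - lam) := by positivity
    refine le_of_mul_le_mul_left ?_ hc
    have h2 := mul_le_mul_of_nonneg_left hs' hc.le
    have h3 := mul_le_mul_of_nonneg_right haΓ hyp
    linarith
  have hterm' : ∀ l < M + 1, lam ^ l * (r ^ p * ‖v l‖ ^ p) ≤ Γ * ‖y‖ ^ p := fun l hl =>
    (mul_le_mul_of_nonneg_left (mul_le_mul_of_nonneg_left (norm_rpow_le_weight hp v l) hrp)
      (by positivity)).trans (hterm l hl)
  have hnorm : ∀ l < M + 1, lam ^ l * (r * ‖v l‖) ≤ Γ * ‖y‖ := by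
    intro l hl
    rw [← Real.rpow_le_rpow_iff (by positivity) (by positivity) hp0,
      Real.mul_rpow (by positivity) (by positivity), Real.mul_rpow hr (by positivity),
      Real.mul_rpow (by positivity) (by positivity)]
    calc (lam ^ l) ^ p * (r ^ p * ‖v l‖ ^ p) ≤ lam ^ l * (r ^ p * ‖v l‖ ^ p) := by
          gcongr
          exact Real.rpow_le_self_of_le_one (by positivity) (pow_le_one₀ h0.le h1.le) hp
      _ ≤ Γ * ‖y‖ ^ p := hterm' l hl
      _ ≤ Γ ^ p * ‖y‖ ^ p := by
          gcongr
          exact Real.self_le_rpow_of_one_le hΓ hp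
  have hsum : ∑ l ∈ Finset.range (M + 1), r * η * (lam ^ 2) ^ l * ‖v l‖ ≤ ‖y‖ / 2 := by
    calc ∑ l ∈ Finset.range (M + 1), r * η * (lam ^ 2) ^ l * ‖v l‖
        ≤ ∑ l ∈ Finset.range (M + 1), η * (Γ * ‖y‖) * lam ^ l := by
          refine Finset.sum_le_sum fun l hl => ?_
          have := mul_le_mul_of_nonneg_left (hnorm l (Finset.mem_range.1 hl))
            (by positivity : 0 ≤ η * lam ^ l)
          calc _ = η * lam ^ l * (lam ^ l * (r * ‖v l‖)) := by rw [← pow_mul]; ring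
            _ ≤ _ := this
            _ = _ := by ring
      _ ≤ η * (Γ * ‖y‖) * (1 - lam)⁻¹ := by
          rw [← Finset.mul_sum]
          exact mul_le_mul_of_nonneg_left (sum_pow_le_inv_one_sub h0.le h1 _) (by positivity)
      _ = η * Γ * (‖y‖ * (1 - lam)⁻¹) := by ring
      _ ≤ (1 - lam) / 2 * (‖y‖ * (1 - lam)⁻¹) := by gcongr
      _ = ‖y‖ / 2 := by field_simp
  have hloss : ∑ l ∈ Finset.range M, (r * η * (lam ^ 2) ^ l) ^ p * ‖v (l + 1)‖ ^ p ≤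
      Γ / lam * (1 - lam)⁻¹ * ‖y‖ ^ p := by
    calc ∑ l ∈ Finset.range M, (r * η * (lam ^ 2) ^ l) ^ p * ‖v (l + 1)‖ ^ p
        ≤ ∑ l ∈ Finset.range M, Γ / lam * ‖y‖ ^ p * lam ^ l := by
          refine Finset.sum_le_sum fun l hl => ?_
          have h2 := hterm' (l + 1) (by have := Finset.mem_range.1 hl; omega)
          have h3 : (η * (lam ^ 2) ^ l) ^ p ≤ lam ^ l * lam ^ l := by
            have h4 : η * (lam ^ 2) ^ l ≤ lam ^ l * lam ^ l := by
              rw [← pow_mul, mul_comm 2 l, pow_mul, sq]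
              exact mul_le_of_le_one_left (by positivity) hη1
            refine (Real.rpow_le_self_of_le_one (by positivity) (h4.trans ?_) hp).trans h4
            exact mul_le_one₀ (pow_le_one₀ h0.le h1.le) (by positivity) (pow_le_one₀ h0.le h1.le)
          rw [mul_assoc r, Real.mul_rpow hr (by positivity)]
          calc r ^ p * (η * (lam ^ 2) ^ l) ^ p * ‖v (l + 1)‖ ^ p
              = (η * (lam ^ 2) ^ l) ^ p * (r ^ p * ‖v (l + 1)‖ ^ p) := by ring
            _ ≤ lam ^ l * lam ^ l * (r ^ p * ‖v (l + 1)‖ ^ p) := by gcongr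
            _ = lam ^ l / lam * (lam ^ (l + 1) * (r ^ p * ‖v (l + 1)‖ ^ p)) := by
                rw [pow_succ]; field_simp
            _ ≤ lam ^ l / lam * (Γ * ‖y‖ ^ p) := by gcongr
            _ = Γ / lam * ‖y‖ ^ p * lam ^ l := by ring
      _ ≤ Γ / lam * ‖y‖ ^ p * (1 - lam)⁻¹ := by
          rw [← Finset.mul_sum]
          exact mul_le_mul_of_nonneg_left (sum_pow_le_inv_one_sub h0.le h1 _) (by positivity)
      _ = Γ / lam * (1 - lam)⁻¹ * ‖y‖ ^ p := by ring
  have hpt : ∀ t, max 0 (1 - rieszFactor t / ε) * (g * ‖y‖ ^ p) + (r * rieszFactor t) ^ p * S ≤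
      indepMoment p M (fun k => v (k + 1)) (y + (r * rieszFactor t) • v 0) (r * rieszFactor t) := by
    intro t
    have hX := rieszFactor_nonneg t
    have hrX : 0 ≤ r * rieszFactor t := mul_nonneg hr hX
    by_cases hal : rieszFactor t ≤ ε
    · have hre : r * rieszFactor t ≤ r * η := by gcongr; linarith
      have hy' : ‖y‖ / 2 + ∑ l ∈ Finset.range M, r * η * (lam ^ 2) ^ (l + 1) * ‖v (l + 1)‖ ≤
          ‖y + (r * rieszFactor t) • v 0‖ := by
        rw [Finset.sum_range_succ', pow_zero, mul_one] at hsum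
        have h2 : ‖y‖ ≤ ‖y + (r * rieszFactor t) • v 0‖ + r * rieszFactor t * ‖v 0‖ := by
          have := norm_sub_le (y + (r * rieszFactor t) • v 0) ((r * rieszFactor t) • v 0)
          rwa [add_sub_cancel_right, norm_smul, Real.norm_of_nonneg hrX] at this
        have h3 : r * rieszFactor t * ‖v 0‖ ≤ r * η * ‖v 0‖ := by gcongr
        linarith
      have h5 := hT (fun k => v (k + 1)) _ _ (r * η) (‖y‖ / 2) hrX hre (by positivity) hy'
      have h6 : κ * √(r * rieszFactor t / (r * η)) ≤ 1 / 2 := by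
        have h61 : r * rieszFactor t / (r * η) ≤ ε / η := by
          rcases hr.eq_or_lt with h | h
          · rw [← h, zero_mul, zero_div]; positivity
          · rw [mul_div_mul_left _ _ h.ne']; gcongr
        exact (mul_le_mul_of_nonneg_left (Real.sqrt_le_sqrt h61) hκ).trans hκε
      have h7 : (‖y‖ / 2) ^ p * (1 / 2) ≤
          (‖y‖ / 2) ^ p * (1 - κ * √(r * rieszFactor t / (r * η))) := by
        gcongr; linarith
      have h8 : (‖y‖ / 2) ^ p = (2 ^ p)⁻¹ * ‖y‖ ^ p := by
        rw [Real.div_rpow (norm_nonneg _) two_pos.le]; ring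
      have h9 := mul_le_mul_of_nonneg_left hloss (by positivity : 0 ≤ b * factorMoment p)
      have h10 : max 0 (1 - rieszFactor t / ε) * (g * ‖y‖ ^ p) ≤ g * ‖y‖ ^ p := by
        refine mul_le_of_le_one_left (by positivity) (max_le zero_le_one ?_)
        have : 0 ≤ rieszFactor t / ε := by positivity
        linarith
      have h11 : g * ‖y‖ ^ p = (2 ^ p)⁻¹ * ‖y‖ ^ p * (1 / 2) -
          b * factorMoment p * (Γ / lam * (1 - lam)⁻¹ * ‖y‖ ^ p) := by rw [hg']; ring
      rw [h8] at h5 h7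
      rw [← hS] at h5
      linarith
    · push Not at hal
      have h5 := hL (fun k => v (k + 1)) (y + (r * rieszFactor t) • v 0) _ hrX
      have h6 : max 0 (1 - rieszFactor t / ε) = 0 := by
        refine max_eq_left ?_
        have := (one_le_div hε).2 hal.le
        linarith
      have h9 : 0 ≤ a * ‖y + (r * rieszFactor t) • v 0‖ ^ p := by positivity
      rw [h6, zero_mul]
      linarith
  have hc0 := continuous_rieszFactor
  have hc1 : Continuous fun t => max 0 (1 - rieszFactor t / ε) * (g * ‖y‖ ^ p) := by fun_prop
  have hc2 := continuous_mul_rieszFactor_rpow hp r S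
  have hmono := integral_mono (μ := 𝔪) (hc1.add hc2).integrable_circle
    (continuous_indepMoment_step hp M (fun k => v (k + 1)) y (v 0) r).integrable_circle hpt
  rw [← indepMoment_succ, integral_add' hc1.integrable_circle hc2.integrable_circle,
    integral_mul_const, integral_mul_rieszFactor_rpow hr] at hmono
  have hs := sum_decayCoeff_weight_succ_le hp hb.le h0.le h1.le M v
  have hs' := mul_le_mul_of_nonneg_left hs hrp
  have hw0 := hterm 0 (by omega)
  have hw1 := mul_le_mul_of_nonneg_left hw0 hb.le
  have hgy := mul_le_mul_of_nonneg_right hg hyp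
  simp only [weight, pow_zero, zero_add, pow_one, one_mul] at hw1
  simp only [← hS] at hs'
  linarith

/-- The choice of the parameters that depend on the factor only: the rate `lam`, the escape constant
`κ`, the domination constant `Γ`, the trapping scale `η` and the size `ε` of the tiny factor. -/
theorem exists_trapping_parameters {A c θ : ℝ} (hA : 1 ≤ A) (hc0 : 0 < c) (hc1 : c ≤ 1)
    (hθ0 : 0 ≤ θ) (hθ1 : θ < 1) :
    ∃ lam κ Γ η ε : ℝ, 0 < lam ∧ lam < 1 ∧ 0 ≤ κ ∧ (κ + 1) * θ = κ * lam ∧ 1 ≤ Γ ∧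
      4 * A = Γ * (c * (1 - lam)) ∧ 0 < η ∧ η ≤ 1 ∧ η * Γ ≤ (1 - lam) / 2 ∧ 0 < ε ∧ ε ≤ η ∧
      κ * √(ε / η) ≤ 1 / 2 := by
  obtain ⟨lam, hlam⟩ : ∃ lam, lam = (1 + θ) / 2 := ⟨_, rfl⟩
  have h0 : 0 < lam := by linarith
  have h1 : lam < 1 := by linarith
  have h1' : 0 < 1 - lam := by linarith
  have hθl : 0 < lam - θ := by linarith
  obtain ⟨κ, hκ⟩ : ∃ κ, κ = θ / (lam - θ) := ⟨_, rfl⟩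
  have hκ0 : 0 ≤ κ := by rw [hκ]; positivity
  have hκe : (κ + 1) * θ = κ * lam := by rw [hκ]; field_simp; ring
  obtain ⟨Γ, hΓ⟩ : ∃ Γ, Γ = 4 * A / (c * (1 - lam)) := ⟨_, rfl⟩
  have hΓ1 : 1 ≤ Γ := by
    rw [hΓ, one_le_div (by positivity)]
    nlinarith
  obtain ⟨η, hη⟩ : ∃ η, η = (1 - lam) / 2 / Γ := ⟨_, rfl⟩
  have hη0 : 0 < η := by rw [hη]; positivity
  have hηΓ : η * Γ = (1 - lam) / 2 := by rw [hη]; exact div_mul_cancel₀ _ (by positivity)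
  have hη1 : η ≤ 1 := by nlinarith
  refine ⟨lam, κ, Γ, η, η / (2 * κ + 1) ^ 2, h0, h1, hκ0, hκe, hΓ1, ?_, hη0, hη1, hηΓ.le,
    by positivity, div_le_self hη0.le (one_le_pow₀ (by linarith)), ?_⟩
  · rw [hΓ]; field_simp
  · have : η / (2 * κ + 1) ^ 2 / η = (1 / (2 * κ + 1)) ^ 2 := by field_simp
    rw [this, Real.sqrt_sq (by positivity), mul_one_div, div_le_div_iff₀ (by positivity) two_pos]
    linarith

/-- The choice of the coefficients `a` and `b` of the lower bound: small enough for the gain `q` of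
a trapped sum to pay for the constant term, for the next vector and for the losses `B`. -/
theorem exists_lowerBound_coefficients {A c lam Γ q π₀ B : ℝ} (hA : 1 ≤ A) (hc0 : 0 < c)
    (hc1 : c ≤ 1) (hΓ1 : 1 ≤ Γ) (hΓ : 4 * A = Γ * (c * (1 - lam))) (hq0 : 0 < q)
    (hq1 : q ≤ 1) (hπ0 : 0 < π₀) (hπ1 : π₀ ≤ 1) (hB : 0 ≤ B) :
    ∃ a b : ℝ, 0 < a ∧ a ≤ 1 ∧ 0 < b ∧ b ≤ a ∧ 2 * b * A = a * c ∧
      a = Γ * (b / 2 * (1 - lam)) ∧ a + b * Γ ≤ π₀ * (q / 2 - b * B) := by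
  obtain ⟨a, ha⟩ : ∃ a, a = π₀ * (q / 2) / (1 + Γ + B) := ⟨_, rfl⟩
  have ha0 : 0 < a := by rw [ha]; positivity
  have ha1 : a ≤ 1 := by
    rw [ha, div_le_one (by positivity)]
    have : π₀ * (q / 2) ≤ 1 * 1 := by gcongr; linarith
    linarith
  obtain ⟨b, hb⟩ : ∃ b, b = a * c / (2 * A) := ⟨_, rfl⟩
  have hb0 : 0 < b := by rw [hb]; positivity
  have hab : 2 * b * A = a * c := by rw [hb]; field_simp
  have hba : b ≤ a := by
    rw [hb, div_le_iff₀ (by positivity)]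
    nlinarith
  refine ⟨a, b, ha0, ha1, hb0, hba, hab, ?_, ?_⟩
  · refine mul_right_cancel₀ hc0.ne' ?_
    linear_combination -hab + (b / 2) * hΓ
  · have h2 : a * (1 + Γ + B) = π₀ * (q / 2) := by
      rw [ha]; exact div_mul_cancel₀ _ (by positivity)
    have h3 : π₀ * (b * B) ≤ a * B :=
      (mul_le_of_le_one_left (by positivity) hπ1).trans (by gcongr)
    have h4 : b * Γ ≤ a * Γ := by gcongr
    linarith

/-- The lower bound in the independent model. -/
theorem exists_indepMoment_lower {p : ℝ} (hp : 1 ≤ p) :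
    ∃ c : ℝ, 0 < c ∧ ∀ (E : Type u) [NormedAddCommGroup E] [NormedSpace ℝ E]
      (M : ℕ) (v : ℕ → E) (y : E) (r : ℝ), 0 ≤ r →
      c * (‖y‖ ^ p + r ^ p * ∑ l ∈ Finset.range M, weight p v l) ≤ indepMoment p M v y r := by
  have hA := one_le_factorMoment hp
  have hc0 := integral_abs_torusCos_rpow_pos (p := p) (by linarith)
  have hc1 := integral_abs_torusCos_rpow_le_one (p := p) (by linarith)
  obtain ⟨lam, κ, Γ, η, ε, h0, h1, hκ0, hκe, hΓ1, hΓ, hη0, hη1, hηΓ, hε0, hεη, hκε⟩ :=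
    exists_trapping_parameters hA hc0 hc1
      (integral_nonneg (μ := 𝔪) fun t => Real.sqrt_nonneg (rieszFactor t))
      integral_sqrt_rieszFactor_lt_one
  have h1' : 0 < 1 - lam := by linarith
  have hφc : Continuous fun t => max 0 (1 - rieszFactor t / ε) := by
    have := continuous_rieszFactor
    fun_prop
  have hπ0 := integral_circle_pos (x := ((Real.pi : ℝ) : 𝕋)) hφc
    (fun t => le_max_left _ _) (by simp [rieszFactor_pi])
  have hπ1 : ∫ t, max 0 (1 - rieszFactor t / ε) ∂𝔪 ≤ 1 := by
    have := integral_mono (μ := 𝔪) (g := fun _ => (1 : ℝ)) hφc.integrable_circle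
      (integrable_const _) fun t => max_le zero_le_one (by
        have : 0 ≤ rieszFactor t / ε := div_nonneg (rieszFactor_nonneg t) hε0.le
        linarith)
    simpa using this
  have h2p : (2 ^ p : ℝ)⁻¹ ≤ 1 := inv_le_one_of_one_le₀ (Real.one_le_rpow one_le_two (by linarith))
  obtain ⟨a, b, ha0, ha1, hb0, hba, hab, haΓ, hg⟩ := exists_lowerBound_coefficients
    (B := factorMoment p * (Γ / lam * (1 - lam)⁻¹)) hA hc0 hc1 hΓ1 hΓ
    (by positivity : (0 : ℝ) < (2 ^ p)⁻¹) h2p hπ0 hπ1 (by positivity)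
  rw [← mul_assoc b] at hg
  have key : ∀ (E : Type u) [NormedAddCommGroup E] [NormedSpace ℝ E] (M : ℕ),
      LowerBound E p a b lam M ∧ TrappedBound E p b lam κ M := by
    intro E _ _ M
    induction M with
    | zero => exact ⟨lowerBound_zero ha1, trappedBound_zero hp hκ0⟩
    | succ M ih =>
      refine ⟨fun v y r hr => ?_,
        trappedBound_succ hp ha0.le hb0.le h0 h1.le hκe hκ0 ih.1 ih.2⟩
      rcases le_total (a * ‖y‖ ^ p) (b / 2 * (1 - lam) *
        (r ^ p * ∑ l ∈ Finset.range (M + 1), lam ^ l * weight p v l)) with h | h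
      · exact lowerBound_succ_of_le hp ha0.le hb0.le h0 hab.le ih.1 v y hr h
      · exact lowerBound_succ_of_ge hp ha0.le hb0 h0 h1 hκ0 hΓ1 haΓ.le hη0 hη1 hηΓ hε0 hεη hκε
          hg ih.1 ih.2 v y hr h
  refine ⟨b / 2, by positivity, fun E _ _ M v y r hr => ?_⟩
  refine le_trans ?_ ((key E M).1 v y r hr)
  rw [mul_add, mul_left_comm, Finset.mul_sum]
  have hyp : 0 ≤ ‖y‖ ^ p := by positivity
  refine add_le_add (by nlinarith) (mul_le_mul_of_nonneg_left ?_ (by positivity))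
  exact Finset.sum_le_sum fun l _ =>
    mul_le_mul_of_nonneg_right (half_le_decayCoeff hb0.le h0.le l) (weight_nonneg hp v l)

/-! ### Upper bound in the independent model -/

theorem mul_rpow_sub_one_eq {p z : ℝ} (hp : 1 ≤ p) (hz : 0 ≤ z) : z * z ^ (p - 1) = z ^ p := by
  rw [← Real.rpow_one_add' hz (by linarith)]; congr 1; ring

theorem add_rpow_le_rpow_add_mul {p a b : ℝ} (hp : 1 ≤ p) (ha : 0 ≤ a) (hb : 0 ≤ b) :
    (a + b) ^ p ≤ a ^ p + p * 2 ^ p * (b * a ^ (p - 1) + b ^ p) := by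
  have hq : 0 ≤ p - 1 := by linarith
  rcases (add_nonneg ha hb).eq_or_lt with h | h
  · rw [← h, Real.zero_rpow (by linarith)]; positivity
  -- the graph of `x ↦ x ^ p` lies above its tangent line at `a + b`
  have h1 : (a + b) ^ p - p * b * (a + b) ^ (p - 1) ≤ a ^ p := by
    have h2 := one_add_mul_self_le_rpow_one_add (s := -b / (a + b))
      (by rw [le_div_iff₀ h]; linarith) hp
    have h3 : 1 + -b / (a + b) = a / (a + b) := by field_simp; ring
    rw [h3, Real.div_rpow ha h.le, le_div_iff₀ (by positivity)] at h2
    have h4 : (a + b) ^ (p - 1) = (a + b) ^ p / (a + b) := Real.rpow_sub_one h.ne' p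
    rw [h4]
    calc _ = (1 + p * (-b / (a + b))) * (a + b) ^ p := by ring
      _ ≤ _ := h2
  have h5 : (a + b) ^ (p - 1) ≤ 2 ^ p * (a ^ (p - 1) + b ^ (p - 1)) := by
    have h6 : a + b ≤ 2 * max a b := by
      have := le_max_left a b
      have := le_max_right a b
      linarith
    calc (a + b) ^ (p - 1) ≤ (2 * max a b) ^ (p - 1) := Real.rpow_le_rpow h.le h6 hq
      _ = 2 ^ (p - 1) * max a b ^ (p - 1) := Real.mul_rpow two_pos.le (le_max_of_le_left ha)
      _ ≤ 2 ^ p * (a ^ (p - 1) + b ^ (p - 1)) := by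
        gcongr
        · norm_num
        · linarith
        · have := Real.rpow_nonneg ha (p - 1)
          have := Real.rpow_nonneg hb (p - 1)
          rcases max_choice a b with h | h <;> rw [h] <;> linarith
  have h7 : b * b ^ (p - 1) = b ^ p := mul_rpow_sub_one_eq hp hb
  have h8 : p * b * (a + b) ^ (p - 1) ≤ p * b * (2 ^ p * (a ^ (p - 1) + b ^ (p - 1))) := by
    gcongr
  have h9 : p * b * (2 ^ p * (a ^ (p - 1) + b ^ (p - 1))) =
      p * 2 ^ p * (b * a ^ (p - 1) + b ^ p) := by rw [← h7]; ring
  linarith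

theorem exists_add_rpow_le {q σ : ℝ} (hq : 0 < q) (hσ : 1 < σ) :
    ∃ C : ℝ, 0 ≤ C ∧ ∀ a b : ℝ, 0 ≤ a → 0 ≤ b → (a + b) ^ q ≤ σ * a ^ q + C * b ^ q := by
  obtain ⟨τ, hτ⟩ : ∃ τ, τ = σ ^ q⁻¹ - 1 := ⟨_, rfl⟩
  have hτ0 : 0 < τ := by
    have := Real.one_lt_rpow hσ (inv_pos.2 hq)
    linarith
  have hτσ : (1 + τ) ^ q = σ := by
    rw [hτ, add_sub_cancel, Real.rpow_inv_rpow (by linarith) hq.ne']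
  refine ⟨(τ⁻¹ + 1) ^ q, by positivity, fun a b ha hb => ?_⟩
  have h1 : 0 ≤ (τ⁻¹ + 1) ^ q * b ^ q := by positivity
  have h2 : 0 ≤ σ * a ^ q := by positivity
  rcases le_total b (τ * a) with h | h
  · have : (a + b) ^ q ≤ ((1 + τ) * a) ^ q :=
      Real.rpow_le_rpow (by positivity) (by linarith) hq.le
    rw [Real.mul_rpow (by positivity) ha, hτσ] at this
    linarith
  · have h3 : a ≤ τ⁻¹ * b := by rwa [inv_mul_eq_div, le_div_iff₀ hτ0, mul_comm]
    have : (a + b) ^ q ≤ ((τ⁻¹ + 1) * b) ^ q :=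
      Real.rpow_le_rpow (by positivity) (by linarith) hq.le
    rw [Real.mul_rpow (by positivity) hb] at this
    linarith

theorem mul_rpow_sub_one_le_add {p x y : ℝ} (hp : 1 < p) (hx : 0 ≤ x) (hy : 0 ≤ y) :
    x * y ^ (p - 1) ≤ x ^ p + y ^ p := by
  have hpow : ∀ z : ℝ, 0 ≤ z → z * z ^ (p - 1) = z ^ p := fun z hz =>
    mul_rpow_sub_one_eq hp.le hz
  have hx' := Real.rpow_nonneg hx p
  have hy' := Real.rpow_nonneg hy p
  rcases le_total x y with h | h
  · have := mul_le_mul_of_nonneg_right h (Real.rpow_nonneg hy (p - 1))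
    rw [hpow y hy] at this
    linarith
  · have := mul_le_mul_of_nonneg_left (Real.rpow_le_rpow hy h (by linarith : 0 ≤ p - 1)) hx
    rw [hpow x hx] at this
    linarith

theorem norm_add_smul_le {r : ℝ} (hr : 0 ≤ r) (y w : E) : ‖y + r • w‖ ≤ ‖y‖ + r * ‖w‖ := by
  have := norm_add_le y (r • w)
  rwa [norm_smul, Real.norm_of_nonneg hr] at this

theorem indepMoment_one_le (M : ℕ) (v : ℕ → E) (y : E) {r : ℝ} (hr : 0 ≤ r) :
    indepMoment 1 M v y r ≤ ‖y‖ + r * ∑ l ∈ Finset.range M, ‖v l‖ := by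
  induction M generalizing v y r with
  | zero => simp [indepMoment_zero]
  | succ M ih =>
    have hX := continuous_rieszFactor
    have hmono := integral_mono (μ := 𝔪) (g := fun t => ‖y‖ + r * rieszFactor t *
        (‖v 0‖ + ∑ l ∈ Finset.range M, ‖v (l + 1)‖))
      (continuous_indepMoment_step le_rfl M (fun k => v (k + 1)) y (v 0) r).integrable_circle
      (Continuous.integrable_circle (by fun_prop))
      (fun t => by
        have hrX := mul_nonneg hr (rieszFactor_nonneg t)
        have h1 := ih (fun k => v (k + 1)) (y + (r * rieszFactor t) • v 0) hrX
        have h2 := norm_add_smul_le hrX y (v 0)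
        simp only
        linarith)
    rw [← indepMoment_succ, integral_add (integrable_const _)
      (Continuous.integrable_circle (by fun_prop)), integral_mul_const, integral_const_mul,
      integral_rieszFactor] at hmono
    rw [Finset.sum_range_succ']
    simp at hmono
    linarith

theorem rpow_mul_norm_mul_rpow_le {F : Type*} [NormedAddCommGroup F] {p : ℝ} (hp : 1 < p)
    (v : ℕ → F) (l : ℕ) {u : ℝ} (hu : 0 ≤ u) :
    (factorMoment p ^ (1 / p)) ^ (l + 1) * ‖v l‖ * u ^ (p - 1) ≤ weight p v l + u ^ p := by
  have hA := factorMoment_pos hp.le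
  have h := mul_rpow_sub_one_le_add hp
    (by positivity : 0 ≤ (factorMoment p ^ (1 / p)) ^ (l + 1) * ‖v l‖) hu
  have h1 : ((factorMoment p ^ (1 / p)) ^ (l + 1) * ‖v l‖) ^ p = weight p v l := by
    rw [Real.mul_rpow (by positivity) (norm_nonneg _), weight, ← Real.rpow_natCast,
      ← Real.rpow_mul hA.le, ← Real.rpow_mul hA.le, ← Real.rpow_natCast]
    congr 2
    field_simp
  rwa [h1] at h

/-- The potential that dominates the moments of the independent model: besides the `p`-th powers it
keeps track of the products `‖y‖ ^ (p - 1) * ‖v l‖`, whose expectations decay since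
`∫ (1 + cos) = 1 < ∫ (1 + cos) ^ p`. -/
theorem indepMoment_le_potential {p σ ρ C L H : ℝ} (hp : 1 < p) (hσ : 1 ≤ σ) (hρ0 : 0 ≤ ρ)
    (hσρ : σ = ρ * factorMoment p ^ (1 / p))
    (hC0 : 0 ≤ C) (hC : ∀ a b : ℝ, 0 ≤ a → 0 ≤ b →
      (a + b) ^ (p - 1) ≤ σ * a ^ (p - 1) + C * b ^ (p - 1))
    (hL0 : 0 ≤ L) (hL : ∀ a b : ℝ, 0 ≤ a → 0 ≤ b →
      (a + b) ^ p ≤ a ^ p + L * (b * a ^ (p - 1) + b ^ p))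
    (hH : L * C ≤ H * (1 - ρ)) (hH' : ∀ M : ℕ, L + L * C * ∑ l ∈ Finset.range M, ρ ^ l ≤ H)
    (M : ℕ) (v : ℕ → E) (y : E) {r : ℝ} (hr : 0 ≤ r) :
    indepMoment p M v y r ≤ ‖y‖ ^ p
      + L * (r * ‖y‖ ^ (p - 1) * ∑ l ∈ Finset.range M, σ ^ l * ‖v l‖)
      + r ^ p * ∑ l ∈ Finset.range M, H * (2 - ρ ^ l) * weight p v l := by
  have hA := factorMoment_pos hp.le
  have hp0 : 0 ≤ p - 1 := by linarith
  induction M generalizing v y r with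
  | zero => simp [indepMoment_zero]
  | succ M ih =>
    set S := ∑ l ∈ Finset.range M, σ ^ l * ‖v (l + 1)‖ with hS
    set W := ∑ l ∈ Finset.range M, H * (2 - ρ ^ l) * weight p (fun k => v (k + 1)) l with hW
    have hS0 : 0 ≤ S := Finset.sum_nonneg fun l _ => by positivity
    set B₁ := L * ‖y‖ ^ (p - 1) * (‖v 0‖ + σ * S) with hB₁
    set B₂ := L * ‖v 0‖ ^ p + L * C * S * ‖v 0‖ ^ (p - 1) + W with hB₂
    have hpt : ∀ t, indepMoment p M (fun k => v (k + 1)) (y + (r * rieszFactor t) • v 0)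
        (r * rieszFactor t) ≤
        ‖y‖ ^ p + r * rieszFactor t * B₁ + (r * rieszFactor t) ^ p * B₂ := by
      intro t
      have hs := mul_nonneg hr (rieszFactor_nonneg t)
      have h1 := ih (fun k => v (k + 1)) (y + (r * rieszFactor t) • v 0) hs
      generalize r * rieszFactor t = s at hs h1 ⊢
      have hn := norm_add_smul_le hs y (v 0)
      have hsv : 0 ≤ s * ‖v 0‖ := by positivity
      have h2 : ‖y + s • v 0‖ ^ p ≤ ‖y‖ ^ p + L * (s * ‖v 0‖ * ‖y‖ ^ (p - 1) + s ^ p * ‖v 0‖ ^ p) := by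
        refine (Real.rpow_le_rpow (norm_nonneg _) hn (by linarith)).trans ?_
        rw [← Real.mul_rpow hs (norm_nonneg _)]
        exact hL _ _ (norm_nonneg _) hsv
      have h3 : s * ‖y + s • v 0‖ ^ (p - 1) ≤
          s * (σ * ‖y‖ ^ (p - 1)) + C * (s ^ p * ‖v 0‖ ^ (p - 1)) := by
        have h4 := (Real.rpow_le_rpow (norm_nonneg _) hn hp0).trans (hC _ _ (norm_nonneg _) hsv)
        rw [Real.mul_rpow hs (norm_nonneg _)] at h4
        have h5 := mul_le_mul_of_nonneg_left h4 hs
        rw [← mul_rpow_sub_one_eq hp.le hs]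
        linarith
      have h4 := mul_le_mul_of_nonneg_left h3 (mul_nonneg hL0 hS0)
      rw [← hS, ← hW] at h1
      rw [hB₁, hB₂]
      linarith
    have hX := continuous_rieszFactor
    have hc1 : Continuous fun t => ‖y‖ ^ p + r * rieszFactor t * B₁ := by fun_prop
    have hc2 := continuous_mul_rieszFactor_rpow hp.le r B₂
    have hmono := integral_mono (μ := 𝔪)
      (continuous_indepMoment_step hp.le M (fun k => v (k + 1)) y (v 0) r).integrable_circle
      (hc1.add hc2).integrable_circle hpt
    rw [← indepMoment_succ, integral_add' hc1.integrable_circle hc2.integrable_circle,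
      integral_mul_rieszFactor_rpow hr, integral_add (integrable_const _)
      (Continuous.integrable_circle (by fun_prop)), integral_mul_const, integral_const_mul,
      integral_rieszFactor] at hmono
    simp only [integral_const, probReal_univ, smul_eq_mul, one_mul, mul_one] at hmono
    have hw0 := weight_nonneg hp.le v 0
    -- the mixed products created at this step
    have hmix : factorMoment p * (S * ‖v 0‖ ^ (p - 1)) ≤
        ∑ l ∈ Finset.range M, ρ ^ l * (weight p v (l + 1) + weight p v 0) := by
      rw [hS, Finset.sum_mul, Finset.mul_sum]
      refine Finset.sum_le_sum fun l _ => ?_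
      set α := factorMoment p ^ (1 / p) with hα
      have hα0 : 0 ≤ α := by positivity
      have hα1 : 1 ≤ α := Real.one_le_rpow (one_le_factorMoment hp.le) (by positivity)
      have hαp : α ^ p = factorMoment p := by
        rw [hα, ← Real.rpow_mul hA.le, one_div_mul_cancel (by linarith), Real.rpow_one]
      have h1 := rpow_mul_norm_mul_rpow_le hp v (l + 1) (by positivity : 0 ≤ α * ‖v 0‖)
      rw [Real.mul_rpow hα0 (norm_nonneg _), Real.mul_rpow hα0 (norm_nonneg _), hαp, ← hα] at h1
      have h2 : factorMoment p * ‖v 0‖ ^ p = weight p v 0 := by simp [weight]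
      rw [h2] at h1
      calc factorMoment p * (σ ^ l * ‖v (l + 1)‖ * ‖v 0‖ ^ (p - 1))
          = ρ ^ l * (α ^ (l + 1) * ‖v (l + 1)‖ * (α ^ (p - 1) * ‖v 0‖ ^ (p - 1))) := by
            rw [← hαp, ← mul_rpow_sub_one_eq hp.le hα0, hσρ]; ring
        _ ≤ ρ ^ l * (α ^ (l + 1 + 1) * ‖v (l + 1)‖ * (α ^ (p - 1) * ‖v 0‖ ^ (p - 1))) := by
            gcongr
            omega
        _ ≤ _ := by gcongr
    have hWs : factorMoment p * W = ∑ l ∈ Finset.range M, H * (2 - ρ ^ l) * weight p v (l + 1) := by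
      rw [hW, Finset.mul_sum]
      exact Finset.sum_congr rfl fun l _ => by
        rw [mul_left_comm, factorMoment_mul_weight_shift]
    have hstep : L * C * (∑ l ∈ Finset.range M, ρ ^ l * weight p v (l + 1)) +
        ∑ l ∈ Finset.range M, H * (2 - ρ ^ l) * weight p v (l + 1) ≤
        ∑ l ∈ Finset.range M, H * (2 - ρ ^ (l + 1)) * weight p v (l + 1) := by
      rw [Finset.mul_sum, ← Finset.sum_add_distrib]
      refine Finset.sum_le_sum fun l _ => ?_
      have h1 := mul_le_mul_of_nonneg_right hH (mul_nonneg (pow_nonneg hρ0 l)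
        (weight_nonneg hp.le v (l + 1)))
      rw [pow_succ]
      linarith
    have hfirst := mul_le_mul_of_nonneg_right (hH' M) hw0
    simp only [mul_add, Finset.sum_add_distrib, ← Finset.sum_mul] at hmix
    have hmix' := mul_le_mul_of_nonneg_left hmix (mul_nonneg hL0 hC0)
    have hAB : factorMoment p * B₂ ≤
        ∑ l ∈ Finset.range (M + 1), H * (2 - ρ ^ l) * weight p v l := by
      rw [Finset.sum_range_succ', hB₂, mul_add, hWs]
      have h2 : factorMoment p * ‖v 0‖ ^ p = weight p v 0 := by simp [weight]
      have h3 : factorMoment p * (L * ‖v 0‖ ^ p + L * C * S * ‖v 0‖ ^ (p - 1)) =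
          L * weight p v 0 + L * C * (factorMoment p * (S * ‖v 0‖ ^ (p - 1))) := by
        rw [← h2]; ring
      rw [h3, pow_zero]
      linarith
    have hAB' := mul_le_mul_of_nonneg_left hAB (by positivity : 0 ≤ r ^ p)
    have hSs : ∑ l ∈ Finset.range (M + 1), σ ^ l * ‖v l‖ = ‖v 0‖ + σ * S := by
      rw [Finset.sum_range_succ', hS, Finset.mul_sum, pow_zero, one_mul, add_comm]
      congr 1
      exact Finset.sum_congr rfl fun l _ => by ring
    rw [hSs]
    have hr1 : r * B₁ = L * (r * ‖y‖ ^ (p - 1) * (‖v 0‖ + σ * S)) := by rw [hB₁]; ring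
    linarith

/-- The upper bound in the independent model. -/
theorem exists_indepMoment_upper {p : ℝ} (hp : 1 ≤ p) :
    ∃ C : ℝ, 0 < C ∧ ∀ (E : Type u) [NormedAddCommGroup E] [NormedSpace ℝ E]
      (M : ℕ) (v : ℕ → E) (y : E) (r : ℝ), 0 ≤ r →
      indepMoment p M v y r ≤ C * (‖y‖ ^ p + r ^ p * ∑ l ∈ Finset.range M, weight p v l) := by
  rcases hp.eq_or_lt with rfl | hp
  · refine ⟨1, one_pos, fun E _ _ M v y r hr => ?_⟩
    simpa [weight, factorMoment_one] using indepMoment_one_le M v y hr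
  have hA := one_lt_factorMoment hp
  have hp0 : 0 < p := by linarith
  -- the square root of `A ^ (1 / p)` leaves room both for the growth `σ` and for the decay `ρ`
  obtain ⟨σ, hσ⟩ : ∃ σ, σ = factorMoment p ^ (1 / (2 * p)) := ⟨_, rfl⟩
  have hσ1 : 1 < σ := by rw [hσ]; exact Real.one_lt_rpow hA (by positivity)
  have hσ2 : σ * σ = factorMoment p ^ (1 / p) := by
    rw [hσ, ← Real.rpow_add (by linarith)]
    congr 1
    field_simp
    norm_num
  obtain ⟨ρ, hρ⟩ : ∃ ρ, ρ = σ⁻¹ := ⟨_, rfl⟩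
  have hρ0 : 0 < ρ := by rw [hρ]; positivity
  have hρ1 : ρ < 1 := by rw [hρ]; exact inv_lt_one_of_one_lt₀ hσ1
  have hσρ : σ = ρ * factorMoment p ^ (1 / p) := by rw [hρ, ← hσ2]; field_simp
  obtain ⟨C, hC0, hC⟩ := exists_add_rpow_le (q := p - 1) (by linarith) hσ1
  obtain ⟨L, hL⟩ : ∃ L, L = p * (2 : ℝ) ^ p := ⟨_, rfl⟩
  have hL0 : 0 < L := by rw [hL]; positivity
  have h1ρ : 0 < 1 - ρ := by linarith
  obtain ⟨H, hH⟩ : ∃ H, H = L + L * C * (1 - ρ)⁻¹ := ⟨_, rfl⟩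
  have hH0 : 0 < H := by rw [hH]; positivity
  have hH1 : L * C ≤ H * (1 - ρ) := by
    rw [hH, add_mul, inv_mul_cancel_right₀ h1ρ.ne']
    have : 0 ≤ L * (1 - ρ) := by positivity
    linarith
  have hH2 : ∀ M : ℕ, L + L * C * ∑ l ∈ Finset.range M, ρ ^ l ≤ H := fun M => by
    rw [hH]
    gcongr
    exact sum_pow_le_inv_one_sub hρ0.le hρ1 M
  refine ⟨1 + L * (1 - ρ)⁻¹ + L + 2 * H, by positivity, fun E _ _ M v y r hr => ?_⟩
  have hV := indepMoment_le_potential hp hσ1.le hρ0.le hσρ hC0 hC hL0.le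
    (fun a b ha hb => by rw [hL]; exact add_rpow_le_rpow_add_mul hp.le ha hb) hH1 hH2 M v y hr
  refine hV.trans ?_
  set w := ∑ l ∈ Finset.range M, weight p v l with hw
  have hw0 : 0 ≤ w := Finset.sum_nonneg fun l _ => weight_nonneg hp.le v l
  have hrp : 0 ≤ r ^ p := by positivity
  have hyp : 0 ≤ ‖y‖ ^ p := by positivity
  have h1 : r ^ p * ∑ l ∈ Finset.range M, H * (2 - ρ ^ l) * weight p v l ≤ r ^ p * (2 * H * w) := by
    rw [hw]
    refine mul_le_mul_of_nonneg_left ?_ hrp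
    rw [Finset.mul_sum]
    refine Finset.sum_le_sum fun l _ =>
      mul_le_mul_of_nonneg_right ?_ (weight_nonneg hp.le v l)
    have : 0 ≤ H * ρ ^ l := by positivity
    linarith
  have h2 : r * ‖y‖ ^ (p - 1) * ∑ l ∈ Finset.range M, σ ^ l * ‖v l‖ ≤
      (1 - ρ)⁻¹ * ‖y‖ ^ p + r ^ p * w := by
    have h3 : ∀ l ∈ Finset.range M, r * ‖y‖ ^ (p - 1) * (σ ^ l * ‖v l‖) ≤
        ρ ^ l * ‖y‖ ^ p + r ^ p * weight p v l := by
      intro l _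
      have h4 := rpow_mul_norm_mul_rpow_le hp (fun k => r • v k) l (norm_nonneg y)
      have h5 : weight p (fun k => r • v k) l = r ^ p * weight p v l := by
        simp only [weight, norm_smul, Real.norm_of_nonneg hr,
          Real.mul_rpow hr (norm_nonneg _)]
        ring
      rw [h5, norm_smul, Real.norm_of_nonneg hr] at h4
      have hα0 : 0 ≤ factorMoment p ^ (1 / p) := by positivity
      have hα1 : 1 ≤ factorMoment p ^ (1 / p) := Real.one_le_rpow hA.le (by positivity)
      have h6 : ρ ^ l ≤ 1 := pow_le_one₀ hρ0.le hρ1.le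
      have h7 : 0 ≤ r ^ p * weight p v l := mul_nonneg hrp (weight_nonneg hp.le v l)
      calc r * ‖y‖ ^ (p - 1) * (σ ^ l * ‖v l‖)
          = ρ ^ l * ((factorMoment p ^ (1 / p)) ^ l * (r * ‖v l‖) * ‖y‖ ^ (p - 1)) := by
            rw [hσρ, mul_pow]; ring
        _ ≤ ρ ^ l * ((factorMoment p ^ (1 / p)) ^ (l + 1) * (r * ‖v l‖) * ‖y‖ ^ (p - 1)) := by
            gcongr
            omega
        _ ≤ ρ ^ l * (r ^ p * weight p v l + ‖y‖ ^ p) := by gcongr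
        _ ≤ _ := by
            have := mul_le_mul_of_nonneg_right h6 h7
            linarith
    calc _ = ∑ l ∈ Finset.range M, r * ‖y‖ ^ (p - 1) * (σ ^ l * ‖v l‖) := Finset.mul_sum _ _ _
      _ ≤ ∑ l ∈ Finset.range M, (ρ ^ l * ‖y‖ ^ p + r ^ p * weight p v l) := Finset.sum_le_sum h3
      _ = (∑ l ∈ Finset.range M, ρ ^ l) * ‖y‖ ^ p + r ^ p * w := by
          rw [Finset.sum_add_distrib, Finset.sum_mul, hw, Finset.mul_sum]
      _ ≤ _ := by
          gcongr
          exact sum_pow_le_inv_one_sub hρ0.le hρ1 M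
  have h8 := mul_le_mul_of_nonneg_left h2 hL0.le
  have h9 : 0 ≤ r ^ p * w := by positivity
  have h10 : 0 ≤ (1 - ρ)⁻¹ := by positivity
  have h11 : 0 ≤ L * (1 - ρ)⁻¹ * (r ^ p * w) := by positivity
  have h12 : 0 ≤ L * ‖y‖ ^ p := by positivity
  have h13 : 0 ≤ 2 * H * ‖y‖ ^ p := by positivity
  linarith

/-! ### Bernstein's inequality for slowly varying curves -/

section Bernstein

variable {F : Type*} [NormedAddCommGroup F] [NormedSpace ℝ F]

variable (F) in
/-- Curves `ℝ → F` that are finite sums of oscillations `s ↦ cos (ω s + φ) • x` with real frequencies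
`|ω| ≤ δ`. -/
def lowFreq (δ : ℝ) : Submodule ℝ (ℝ → F) :=
  Submodule.span ℝ {U | ∃ (ω φ : ℝ) (x : F), |ω| ≤ δ ∧ U = fun s => Real.cos (ω * s + φ) • x}

/-- The Fourier series of `x ^ 2` on `[-π, π]`. -/
theorem hasSum_cos_sq {x : ℝ} (hx : |x| ≤ Real.pi) :
    HasSum (fun n : ℕ => 1 / (n : ℝ) ^ 2 * (-1) ^ n * Real.cos (n * x))
      (x ^ 2 / 4 - Real.pi ^ 2 / 12) := by
  have hπ := Real.pi_pos
  obtain ⟨h1, h2⟩ := abs_le.1 hx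
  have hu : (x + Real.pi) / (2 * Real.pi) ∈ Set.Icc (0 : ℝ) 1 :=
    ⟨div_nonneg (by linarith) (by linarith), (div_le_one (by linarith)).2 (by linarith)⟩
  have h := hasSum_one_div_nat_pow_mul_cos one_ne_zero hu
  have hB : (Polynomial.map (algebraMap ℚ ℝ) (Polynomial.bernoulli (2 * 1))).eval
      ((x + Real.pi) / (2 * Real.pi)) = ((x + Real.pi) / (2 * Real.pi)) ^ 2
        - (x + Real.pi) / (2 * Real.pi) + 1 / 6 := by
    simp [Polynomial.bernoulli_def, Finset.sum_range_succ, bernoulli_eq_bernoulli'_of_ne_one,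
      bernoulli'_two, bernoulli_one, Polynomial.eval_add, Nat.choose]
    ring
  rw [hB] at h
  convert! h using 1
  · ext n
    rw [mul_one, mul_assoc]
    congr 1
    rw [show 2 * Real.pi * n * ((x + Real.pi) / (2 * Real.pi)) = n * x + n * Real.pi by
      field_simp, Real.cos_add_nat_mul_pi]
  · norm_num [Nat.factorial]
    field_simp
    ring

/-- The second derivative of a slowly varying curve is a combination of its translates. -/
theorem lowFreq_exists_deriv {δ : ℝ} (hδ : 0 < δ) {U : ℝ → F} (hU : U ∈ lowFreq F δ) :
    ∃ U₁ U₂ : ℝ → F, (∀ s, HasDerivAt U (U₁ s) s) ∧ (∀ s, HasDerivAt U₁ (U₂ s) s) ∧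
      ∀ s, HasSum (fun n : ℕ => (1 / (n : ℝ) ^ 2 * (-1) ^ n / 2) •
          (U (s + n * (Real.pi / δ)) + U (s - n * (Real.pi / δ))))
        (-(Real.pi ^ 2 / (4 * δ ^ 2)) • U₂ s - (Real.pi ^ 2 / 12) • U s) := by
  induction hU using Submodule.span_induction with
  | mem U h =>
    obtain ⟨ω, φ, x, hω, rfl⟩ := h
    refine ⟨fun s => (-ω * Real.sin (ω * s + φ)) • x,
      fun s => (-ω ^ 2 * Real.cos (ω * s + φ)) • x, fun s => ?_, fun s => ?_, fun s => ?_⟩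
    · have h1 : HasDerivAt (fun s : ℝ => ω * s + φ) ω s := by
        simpa using ((hasDerivAt_id s).const_mul ω).add_const φ
      convert! h1.cos.smul_const x using 1
      ring_nf
    · have h1 : HasDerivAt (fun s : ℝ => ω * s + φ) ω s := by
        simpa using ((hasDerivAt_id s).const_mul ω).add_const φ
      convert! (h1.sin.const_mul (-ω)).smul_const x using 1
      ring_nf
    · have hx : |Real.pi * (ω / δ)| ≤ Real.pi := by
        rw [abs_mul, abs_of_pos Real.pi_pos, abs_div, abs_of_pos hδ]
        exact mul_le_of_le_one_right Real.pi_pos.le ((div_le_one hδ).2 hω)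
      have h := ((hasSum_cos_sq hx).mul_right (Real.cos (ω * s + φ))).smul_const x
      convert! h using 1
      · ext n
        rw [← add_smul, smul_smul]
        congr 1
        have h1 : ω * (s + n * (Real.pi / δ)) + φ = (ω * s + φ) + n * (Real.pi * (ω / δ)) := by ring
        have h2 : ω * (s - n * (Real.pi / δ)) + φ = (ω * s + φ) - n * (Real.pi * (ω / δ)) := by ring
        rw [h1, h2, Real.cos_add, Real.cos_sub]
        ring
      · rw [smul_smul, smul_smul, ← sub_smul]
        congr 1
        field_simp
  | zero =>
    refine ⟨0, 0, fun s => hasDerivAt_const s 0, fun s => hasDerivAt_const s 0, fun s => ?_⟩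
    simp
  | add U V _ _ hU hV =>
    obtain ⟨U₁, U₂, h1, h2, h3⟩ := hU
    obtain ⟨V₁, V₂, k1, k2, k3⟩ := hV
    refine ⟨U₁ + V₁, U₂ + V₂, fun s => (h1 s).add (k1 s), fun s => (h2 s).add (k2 s), fun s => ?_⟩
    convert! (h3 s).add (k3 s) using 1
    · ext n
      simp only [Pi.add_apply]
      module
    · simp only [Pi.add_apply]
      module
  | smul c U _ hU =>
    obtain ⟨U₁, U₂, h1, h2, h3⟩ := hU
    refine ⟨c • U₁, c • U₂, fun s => (h1 s).const_smul c, fun s => (h2 s).const_smul c,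
      fun s => ?_⟩
    convert! (h3 s).const_smul c using 1
    · ext n
      simp only [Pi.smul_apply]
      module
    · simp only [Pi.smul_apply]
      module

theorem norm_secondDeriv_le_of_hasSum {δ m : ℝ} (hδ : 0 < δ) {U U₂ : ℝ → F}
    (hm : ∀ s, ‖U s‖ ≤ m)
    (hs : ∀ s, HasSum (fun n : ℕ => (1 / (n : ℝ) ^ 2 * (-1) ^ n / 2) •
          (U (s + n * (Real.pi / δ)) + U (s - n * (Real.pi / δ))))
        (-(Real.pi ^ 2 / (4 * δ ^ 2)) • U₂ s - (Real.pi ^ 2 / 12) • U s)) (s : ℝ) :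
    ‖U₂ s‖ ≤ δ ^ 2 * m := by
  have hz : HasSum (fun n : ℕ => 1 / (n : ℝ) ^ 2 * m) (Real.pi ^ 2 / 6 * m) :=
    hasSum_zeta_two.mul_right m
  have h1 : ‖-(Real.pi ^ 2 / (4 * δ ^ 2)) • U₂ s - (Real.pi ^ 2 / 12) • U s‖ ≤
      Real.pi ^ 2 / 6 * m := by
    refine (hs s).norm_le_of_bounded hz fun n => ?_
    rw [norm_smul]
    have h2 : ‖1 / (n : ℝ) ^ 2 * (-1) ^ n / 2‖ = 1 / (n : ℝ) ^ 2 / 2 := by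
      rw [norm_div, norm_mul, norm_pow, norm_neg, norm_one, one_pow, mul_one, Real.norm_two,
        Real.norm_of_nonneg (by positivity)]
    rw [h2]
    have h3 := norm_add_le (U (s + n * (Real.pi / δ))) (U (s - n * (Real.pi / δ)))
    have h4 := hm (s + n * (Real.pi / δ))
    have h5 := hm (s - n * (Real.pi / δ))
    calc _ ≤ 1 / (n : ℝ) ^ 2 / 2 * (2 * m) := by gcongr; linarith
      _ = _ := by ring
  have h2 : ‖(Real.pi ^ 2 / (4 * δ ^ 2)) • U₂ s‖ ≤ Real.pi ^ 2 / 6 * m + Real.pi ^ 2 / 12 * m := by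
    have h3 : (Real.pi ^ 2 / (4 * δ ^ 2)) • U₂ s =
        -(-(Real.pi ^ 2 / (4 * δ ^ 2)) • U₂ s - (Real.pi ^ 2 / 12) • U s)
          - (Real.pi ^ 2 / 12) • U s := by module
    rw [h3]
    refine (norm_sub_le _ _).trans (add_le_add (by rwa [norm_neg]) ?_)
    rw [norm_smul, Real.norm_of_nonneg (by positivity)]
    gcongr
    exact hm s
  rw [norm_smul, Real.norm_of_nonneg (by positivity)] at h2
  have hπ := Real.pi_pos
  rw [div_mul_eq_mul_div, div_le_iff₀ (by positivity)] at h2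
  refine le_of_mul_le_mul_left ?_ (by positivity : 0 < Real.pi ^ 2)
  linarith

theorem norm_secondDifference_le {U U₁ U₂ : ℝ → F} {B : ℝ} (h1 : ∀ s, HasDerivAt U (U₁ s) s)
    (h2 : ∀ s, HasDerivAt U₁ (U₂ s) s) (hB : ∀ s, ‖U₂ s‖ ≤ B) (s h : ℝ) :
    ‖U (s + h) + U (s - h) - (2 : ℝ) • U s‖ ≤ 2 * B * h ^ 2 := by
  have hd : ∀ r, HasDerivAt (fun r => U (s + r) + U (s - r)) (U₁ (s + r) - U₁ (s - r)) r := by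
    intro r
    have := ((h1 (s + r)).comp_const_add s r).add ((h1 (s - r)).comp_const_sub s r)
    rwa [← sub_eq_add_neg] at this
  have hmv : ∀ a b, ‖U₁ b - U₁ a‖ ≤ B * ‖b - a‖ := fun a b =>
    convex_univ.norm_image_sub_le_of_norm_hasDerivWithin_le
      (fun x _ => (h2 x).hasDerivWithinAt) (fun x _ => hB x) (Set.mem_univ a) (Set.mem_univ b)
  have hB0 : 0 ≤ B := (norm_nonneg _).trans (hB 0)
  have hb : ∀ r ∈ Set.Icc (-|h|) |h|, ‖U₁ (s + r) - U₁ (s - r)‖ ≤ 2 * B * |h| := by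
    intro r hr
    have h3 := hmv (s - r) (s + r)
    have h4 : ‖s + r - (s - r)‖ ≤ 2 * |h| := by
      rw [Real.norm_eq_abs, show s + r - (s - r) = 2 * r by ring, abs_mul, abs_two]
      have := abs_le.2 ⟨hr.1, hr.2⟩
      linarith
    calc _ ≤ B * ‖s + r - (s - r)‖ := h3
      _ ≤ B * (2 * |h|) := by gcongr
      _ = _ := by ring
  have h5 := (convex_Icc (-|h|) |h|).norm_image_sub_le_of_norm_hasDerivWithin_le
    (fun r _ => (hd r).hasDerivWithinAt) hb (x := 0) (y := h)
    (by simp) ⟨neg_abs_le h, le_abs_self h⟩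
  simp only [add_zero, sub_zero, Real.norm_eq_abs] at h5
  rw [two_smul]
  calc _ ≤ 2 * B * |h| * |h| := h5
    _ = 2 * B * h ^ 2 := by rw [mul_assoc, abs_mul_abs_self, sq]

/-- A slowly varying curve whose norm is `2π`-periodic has almost constant norm. At a maximum point
`s₀` of the norm, `U s₀` is nearly the midpoint of `U s'` and of the reflection of `U s'`, and the
latter is no longer than `U s₀`. The error is of second order in `δ`. -/
theorem lowFreq_norm_le {δ : ℝ} (hδ : 0 < δ) {U : ℝ → F} (hU : U ∈ lowFreq F δ)
    (hper : Function.Periodic (fun s => ‖U s‖) (2 * Real.pi)) (s s' : ℝ) :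
    (1 - 2 * Real.pi ^ 2 * δ ^ 2) * ‖U s‖ ≤ ‖U s'‖ := by
  obtain ⟨U₁, U₂, h1, h2, h3⟩ := lowFreq_exists_deriv hδ hU
  have hc : Continuous fun s => ‖U s‖ :=
    (continuous_iff_continuousAt.2 fun s => (h1 s).continuousAt).norm
  have hπ := Real.pi_pos
  obtain ⟨s₀, hs₀, hmax⟩ := (isCompact_Icc (a := s' - Real.pi) (b := s' + Real.pi)).exists_isMaxOn
    ⟨s', by constructor <;> linarith⟩ hc.continuousOn
  have hm : ∀ t, ‖U t‖ ≤ ‖U s₀‖ := by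
    intro t
    obtain ⟨y, hy, hty⟩ := hper.exists_mem_Ico (by positivity) t (s' - Real.pi)
    rw [hty]
    exact hmax ⟨hy.1, by linarith [hy.2]⟩
  have hD := norm_secondDifference_le h1 h2 (norm_secondDeriv_le_of_hasSum hδ hm h3) s₀ (s' - s₀)
  rw [add_sub_cancel] at hD
  have hh : (s' - s₀) ^ 2 ≤ Real.pi ^ 2 := by
    rw [sq_le_sq, abs_of_pos hπ, abs_le]
    constructor <;> linarith [hs₀.1, hs₀.2]
  have h4 : ‖(2 : ℝ) • U s₀‖ ≤ ‖U s'‖ + ‖U s₀‖ + 2 * (δ ^ 2 * ‖U s₀‖) * Real.pi ^ 2 := by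
    have h5 : (2 : ℝ) • U s₀ = U s' + U (s₀ - (s' - s₀)) -
        (U s' + U (s₀ - (s' - s₀)) - (2 : ℝ) • U s₀) := by abel
    rw [h5]
    refine (norm_sub_le _ _).trans (add_le_add ((norm_add_le _ _).trans
      (add_le_add le_rfl (hm _))) (hD.trans ?_))
    gcongr
  rw [norm_smul, Real.norm_two] at h4
  rcases le_total (1 - 2 * Real.pi ^ 2 * δ ^ 2) 0 with h | h
  · exact (mul_nonpos_of_nonpos_of_nonneg h (norm_nonneg _)).trans (norm_nonneg _)
  · have h5 := mul_le_mul_of_nonneg_left (hm s) h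
    linarith

end Bernstein

/-! ### Trigonometric polynomials on the circle -/

variable (E) in
/-- Vector-valued trigonometric polynomials of degree at most `d`. -/
noncomputable def trigPoly (d : ℝ) : Submodule ℝ C(𝕋, E) :=
  Submodule.span ℝ {f | ∃ (k : ℤ) (φ : 𝕋) (x : E), |(k : ℝ)| ≤ d ∧
    ∀ t, f t = torusCos (k • t + φ) • x}

theorem trigPoly_mono {d d' : ℝ} (h : d ≤ d') : trigPoly E d ≤ trigPoly E d' :=
  Submodule.span_mono fun _ ⟨k, φ, x, hk, hf⟩ => ⟨k, φ, x, hk.trans h, hf⟩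

theorem one_mem_trigPoly {d : ℝ} (hd : 0 ≤ d) : (1 : C(𝕋, ℝ)) ∈ trigPoly ℝ d :=
  Submodule.subset_span ⟨0, 0, 1, by simpa using hd, fun t => by
    simp [show torusCos 0 = 1 from Real.cos_zero]⟩

/-- The factor `1 + cos (m t)` as a continuous function. -/
noncomputable def rieszFactorMap (m : ℕ) : C(𝕋, ℝ) :=
  ⟨fun t => rieszFactor (m • t), continuous_rieszFactor.comp (continuous_nsmul m)⟩

theorem mul_rieszFactorMap_mem {d : ℝ} {f : C(𝕋, ℝ)} (hf : f ∈ trigPoly ℝ d) (m : ℕ) :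
    f * rieszFactorMap m ∈ trigPoly ℝ (d + m) := by
  let T : C(𝕋, ℝ) →ₗ[ℝ] C(𝕋, ℝ) := LinearMap.mulRight ℝ (rieszFactorMap m)
  have h : trigPoly ℝ d ≤ (trigPoly ℝ (d + m)).comap T := by
    refine Submodule.span_le.2 ?_
    rintro g ⟨k, φ, x, hk, hg⟩
    have hgd : g ∈ trigPoly ℝ (d + m) := trigPoly_mono (by simp)
      (Submodule.subset_span ⟨k, φ, x, hk, hg⟩)
    have hkm := abs_le.1 hk
    have hm0 : (0 : ℝ) ≤ m := m.cast_nonneg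
    have h1 : ∀ σ : ℤ, (σ = m ∨ σ = -m) → (⟨fun t => torusCos ((k + σ) • t + φ) • (x / 2),
        by have := continuous_torusCos; fun_prop⟩ : C(𝕋, ℝ)) ∈ trigPoly ℝ (d + m) := by
      intro σ hσ
      refine Submodule.subset_span ⟨k + σ, φ, x / 2, ?_, fun t => rfl⟩
      rcases hσ with rfl | rfl <;> push_cast <;> rw [abs_le] <;> constructor <;> linarith
    have h2 : T g = g + (⟨fun t => torusCos ((k + (m : ℤ)) • t + φ) • (x / 2),
        by have := continuous_torusCos; fun_prop⟩ : C(𝕋, ℝ)) +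
        (⟨fun t => torusCos ((k + -(m : ℤ)) • t + φ) • (x / 2),
        by have := continuous_torusCos; fun_prop⟩ : C(𝕋, ℝ)) := by
      ext t
      have h3 := torusCos_mul (k • t + φ) (m • t)
      have h4 : k • t + φ + m • t = (k + (m : ℤ)) • t + φ := by
        rw [add_smul, natCast_zsmul]; abel
      have h5 : k • t + φ - m • t = (k + -(m : ℤ)) • t + φ := by
        rw [add_smul, neg_smul, natCast_zsmul]; abel
      rw [h4, h5] at h3
      simp only [T, LinearMap.mulRight_apply, ContinuousMap.mul_apply, ContinuousMap.add_apply,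
        rieszFactorMap, ContinuousMap.coe_mk, hg, rieszFactor, smul_eq_mul]
      linear_combination x * h3
    change T g ∈ trigPoly ℝ (d + m)
    rw [h2]
    exact add_mem (add_mem hgd (h1 _ (Or.inl rfl))) (h1 _ (Or.inr rfl))
  exact h hf

/-- The function `t ↦ f t • x`. -/
noncomputable def ContinuousMap.smulVec (x : E) : C(𝕋, ℝ) →ₗ[ℝ] C(𝕋, E) where
  toFun f := ⟨fun t => f t • x, by fun_prop⟩
  map_add' f g := by ext t; simp [add_smul]
  map_smul' c f := by ext t; simp [mul_smul]

theorem smulVec_apply (x : E) (f : C(𝕋, ℝ)) (t : 𝕋) :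
    ContinuousMap.smulVec x f t = f t • x := rfl

theorem smulVec_mem_trigPoly {d : ℝ} {f : C(𝕋, ℝ)} (hf : f ∈ trigPoly ℝ d) (x : E) :
    ContinuousMap.smulVec x f ∈ trigPoly E d := by
  have h : trigPoly ℝ d ≤ (trigPoly E d).comap (ContinuousMap.smulVec x) := by
    refine Submodule.span_le.2 ?_
    rintro g ⟨k, φ, c, hk, hg⟩
    exact Submodule.subset_span ⟨k, φ, c • x, hk, fun t => by
      rw [smulVec_apply, hg, smul_assoc]⟩
  exact h hf

theorem integral_mul_torusCos_eq_zero {d : ℝ} {f : C(𝕋, ℝ)} (hf : f ∈ trigPoly ℝ d) {m : ℕ}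
    (hm : d < m) : ∫ t, f t * torusCos (m • t) ∂𝔪 = 0 := by
  have hc : Continuous fun t : 𝕋 => torusCos (m • t) :=
    continuous_torusCos.comp (continuous_nsmul m)
  induction hf using Submodule.span_induction with
  | mem g h =>
    obtain ⟨k, φ, x, hk, hg⟩ := h
    have hkm := abs_le.1 hk
    have h1 : ∀ t, g t * torusCos (m • t) =
        (torusCos ((k + (m : ℤ)) • t + φ) + torusCos ((k - (m : ℤ)) • t + φ)) * (x / 2) := by
      intro t
      have h3 := torusCos_mul (k • t + φ) (m • t)
      have h4 : k • t + φ + m • t = (k + (m : ℤ)) • t + φ := by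
        rw [add_smul, natCast_zsmul]; abel
      have h5 : k • t + φ - m • t = (k - (m : ℤ)) • t + φ := by
        rw [sub_smul, natCast_zsmul]; abel
      rw [h4, h5] at h3
      rw [hg, smul_eq_mul]
      linear_combination x * h3
    have hT := continuous_torusCos
    simp_rw [h1]
    rw [integral_mul_const, integral_add (Continuous.integrable_circle (by fun_prop))
      (Continuous.integrable_circle (by fun_prop)), integral_torusCos_zsmul_add,
      integral_torusCos_zsmul_add]
    · simp
    · intro h
      have : (k : ℝ) = m := by exact_mod_cast sub_eq_zero.1 h
      linarith
    · intro h
      have : (k : ℝ) + m = 0 := by exact_mod_cast h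
      linarith
  | zero => simp
  | add g h _ _ hg hh =>
    simp only [ContinuousMap.add_apply, add_mul]
    rw [integral_add (Continuous.integrable_circle (by fun_prop))
      (Continuous.integrable_circle (by fun_prop)), hg, hh, add_zero]
  | smul c g _ hg =>
    simp only [ContinuousMap.smul_apply, smul_eq_mul, mul_assoc]
    rw [integral_const_mul, hg, mul_zero]

/-! ### Replacing a lacunary factor by an independent one -/

theorem norm_toLp_rpow {p : ℝ} (hp : 1 ≤ p) [Fact (1 ≤ ENNReal.ofReal p)] (f : C(𝕋, E)) :
    ‖ContinuousMap.toLp (ENNReal.ofReal p) 𝔪 ℝ f‖ ^ p = ∫ t, ‖f t‖ ^ p ∂𝔪 := by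
  have hp0 : 0 < p := by linarith
  have hae := ContinuousMap.coeFn_toLp (p := ENNReal.ofReal p) (𝕜 := ℝ) 𝔪 f
  have hm : MemLp f (ENNReal.ofReal p) 𝔪 :=
    (memLp_congr_ae hae).1 (Lp.memLp (ContinuousMap.toLp (ENNReal.ofReal p) 𝔪 ℝ f))
  have hi : 0 ≤ ∫ t, ‖f t‖ ^ p ∂𝔪 := integral_nonneg fun t => by positivity
  rw [Lp.norm_def, eLpNorm_congr_ae hae, hm.eLpNorm_eq_integral_rpow_norm
    (by simpa using hp0) ENNReal.ofReal_ne_top, ENNReal.toReal_ofReal hp0.le,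
    ENNReal.toReal_ofReal (by positivity), Real.rpow_inv_rpow hi hp0.ne']

/-- The curve of translates `s ↦ [t ↦ c t • f (t - s / m)]` in `L^p`, linear in `f`. -/
noncomputable def translateCurve (p : ENNReal) [Fact (1 ≤ p)] (c : C(𝕋, ℝ)) (m : ℕ) :
    C(𝕋, E) →ₗ[ℝ] (ℝ → Lp E p 𝔪) where
  toFun f s := ContinuousMap.toLp p 𝔪 ℝ
    ⟨fun t => c t • f (t - ((s / m : ℝ) : 𝕋)), by fun_prop⟩
  map_add' f g := by
    ext1 s
    rw [Pi.add_apply, ← map_add]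
    congr 1
    ext t
    simp
  map_smul' a f := by
    ext1 s
    rw [Pi.smul_apply, ← map_smul]
    congr 1
    ext t
    simp [smul_comm a]

/-- Relative to a frequency `m`, polynomials of degree at most `δ m` are translated slowly. -/
theorem translateCurve_mem_lowFreq {p : ENNReal} [Fact (1 ≤ p)] (c : C(𝕋, ℝ)) {m : ℕ} (hm : 0 < m)
    {d δ : ℝ} (hd : d ≤ δ * m) {f : C(𝕋, E)} (hf : f ∈ trigPoly E d) :
    translateCurve p c m f ∈ lowFreq (Lp E p 𝔪) δ := by
  have hm' : (0 : ℝ) < m := by exact_mod_cast hm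
  have h : trigPoly E d ≤ (lowFreq (Lp E p 𝔪) δ).comap (translateCurve p c m) := by
    refine Submodule.span_le.2 ?_
    rintro g ⟨k, φ, x, hk, hg⟩
    have hT := continuous_torusCos
    let g₁ : C(𝕋, E) := ⟨fun t => c t • torusCos (k • t + φ) • x, by fun_prop⟩
    let g₂ : C(𝕋, E) :=
      ⟨fun t => c t • torusCos (k • t + φ - (Real.pi / 2 : ℝ)) • x, by fun_prop⟩
    have hω : |(k : ℝ) / m| ≤ δ := by
      rw [abs_div, abs_of_pos hm', div_le_iff₀ hm']
      exact hk.trans hd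
    have h1 : translateCurve p c m g =
        (fun s => Real.cos ((k : ℝ) / m * s + 0) • ContinuousMap.toLp p 𝔪 ℝ g₁) +
        fun s => Real.cos ((k : ℝ) / m * s + -(Real.pi / 2)) • ContinuousMap.toLp p 𝔪 ℝ g₂ := by
      ext1 s
      rw [Pi.add_apply, ← map_smul, ← map_smul, ← map_add]
      change ContinuousMap.toLp p 𝔪 ℝ _ = _
      congr 1
      ext t
      have h2 : k • (t - ((s / m : ℝ) : 𝕋)) + φ = k • t + φ - ((k / m * s : ℝ) : 𝕋) := by
        rw [smul_sub, ← AddCircle.coe_zsmul, zsmul_eq_mul, sub_add_eq_add_sub]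
        congr 2
        ring
      simp only [ContinuousMap.coe_mk, ContinuousMap.add_apply, ContinuousMap.smul_apply, g₁, g₂,
        hg, h2, add_zero, ← sub_eq_add_neg]
      rw [torusCos_sub_coe _ (k / m * s)]
      module
    change translateCurve p c m g ∈ lowFreq (Lp E p 𝔪) δ
    rw [h1]
    exact add_mem (Submodule.subset_span ⟨_, _, _, hω, rfl⟩)
      (Submodule.subset_span ⟨_, _, _, hω, rfl⟩)
  exact h hf

/-- The `p`-th moment of `a + b (1 + cos (m t + s)) w` hardly depends on the phase `s` when the
degrees of `a` and `b` are small compared with `m`. -/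
theorem integral_norm_phase_le {p : ℝ} (hp : 1 ≤ p) {m : ℕ} (hm : 0 < m) {d δ : ℝ} (hδ : 0 < δ)
    (hd : d ≤ δ * m) (hδ1 : 0 ≤ 1 - 2 * Real.pi ^ 2 * δ ^ 2) {a : C(𝕋, E)} (ha : a ∈ trigPoly E d)
    {b : C(𝕋, ℝ)} (hb : b ∈ trigPoly ℝ d) (w : E) (s s' : 𝕋) :
    (1 - 2 * Real.pi ^ 2 * δ ^ 2) ^ p * ∫ t, ‖a t + (b t * rieszFactor (m • t + s)) • w‖ ^ p ∂𝔪
      ≤ ∫ t, ‖a t + (b t * rieszFactor (m • t + s')) • w‖ ^ p ∂𝔪 := by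
  have : Fact (1 ≤ ENNReal.ofReal p) := ⟨by simpa using hp⟩
  have hm' : (m : ℝ) ≠ 0 := by exact_mod_cast hm.ne'
  let U : ℝ → Lp E (ENNReal.ofReal p) 𝔪 :=
    translateCurve (ENNReal.ofReal p) 1 m a +
      translateCurve (ENNReal.ofReal p) (rieszFactorMap m) m (ContinuousMap.smulVec w b)
  have hU : U ∈ lowFreq (Lp E (ENNReal.ofReal p) 𝔪) δ :=
    add_mem (translateCurve_mem_lowFreq _ hm hd ha)
      (translateCurve_mem_lowFreq _ hm hd (smulVec_mem_trigPoly hb w))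
  have hnorm : ∀ s : ℝ, ‖U s‖ ^ p =
      ∫ t, ‖a t + (b t * rieszFactor (m • t + (s : 𝕋))) • w‖ ^ p ∂𝔪 := by
    intro s
    have h1 : U s = ContinuousMap.toLp (ENNReal.ofReal p) 𝔪 ℝ
        (⟨fun t => (1 : ℝ) • a (t - ((s / m : ℝ) : 𝕋)), by fun_prop⟩ +
        ⟨fun t => rieszFactorMap m t • (b (t - ((s / m : ℝ) : 𝕋)) • w), by fun_prop⟩) := by
      rw [map_add]; rfl
    rw [h1, norm_toLp_rpow hp, ← integral_add_right_eq_self _ ((s / m : ℝ) : 𝕋)]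
    congr 1
    ext t
    have h2 : m • (t + ((s / m : ℝ) : 𝕋)) = m • t + (s : 𝕋) := by
      rw [smul_add, ← AddCircle.coe_nsmul, nsmul_eq_mul, mul_div_cancel₀ _ hm']
    simp only [ContinuousMap.add_apply, ContinuousMap.coe_mk, add_sub_cancel_right, one_smul,
      rieszFactorMap, h2, smul_smul, mul_comm (b t)]
  have hper : Function.Periodic (fun s => ‖U s‖) (2 * Real.pi) := by
    intro s
    have h1 : ‖U (s + 2 * Real.pi)‖ ^ p = ‖U s‖ ^ p := by
      rw [hnorm, hnorm, AddCircle.coe_add, AddCircle.coe_period, add_zero]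
    exact (Real.rpow_left_inj (norm_nonneg _) (norm_nonneg _) (by linarith)).1 h1
  induction s using QuotientAddGroup.induction_on with
  | H s =>
    induction s' using QuotientAddGroup.induction_on with
    | H s' =>
      have h := Real.rpow_le_rpow (by positivity) (lowFreq_norm_le hδ hU hper s s')
        (by linarith : 0 ≤ p)
      rw [Real.mul_rpow hδ1 (norm_nonneg _), hnorm, hnorm] at h
      exact h

theorem integral_circle_swap {f : 𝕋 → 𝕋 → ℝ} (hf : Continuous fun q : 𝕋 × 𝕋 => f q.1 q.2) :
    ∫ s, ∫ t, f s t ∂𝔪 ∂𝔪 = ∫ t, ∫ s, f s t ∂𝔪 ∂𝔪 :=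
  integral_integral_swap_of_hasCompactSupport hf (HasCompactSupport.of_compactSpace _)

/-- The phase comparison persists after averaging over further independent factors. -/
theorem integral_indepMoment_phase_le {p : ℝ} (hp : 1 ≤ p) {m : ℕ} (hm : 0 < m) {d δ : ℝ}
    (hδ : 0 < δ) (hd : d ≤ δ * m) (hδ1 : 0 ≤ 1 - 2 * Real.pi ^ 2 * δ ^ 2) {a : C(𝕋, E)}
    (ha : a ∈ trigPoly E d) {b : C(𝕋, ℝ)} (hb : b ∈ trigPoly ℝ d) (M : ℕ) (v : ℕ → E) (w : E)
    (x : ℝ) (s s' : 𝕋) :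
    (1 - 2 * Real.pi ^ 2 * δ ^ 2) ^ p *
      ∫ t, indepMoment p M v (a t + (b t * rieszFactor (m • t + s)) • w)
        (b t * rieszFactor (m • t + s) * x) ∂𝔪
      ≤ ∫ t, indepMoment p M v (a t + (b t * rieszFactor (m • t + s')) • w)
        (b t * rieszFactor (m • t + s') * x) ∂𝔪 := by
  have hp0 : 0 ≤ p := by linarith
  have hX := continuous_rieszFactor
  induction M generalizing v w x with
  | zero => exact integral_norm_phase_le hp hm hδ hd hδ1 ha hb w s s'
  | succ M ih =>
    have hcont : ∀ s : 𝕋, Continuous fun q : 𝕋 × 𝕋 => indepMoment p M (fun k => v (k + 1))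
        (a q.1 + (b q.1 * rieszFactor (m • q.1 + s)) • (w + (x * rieszFactor q.2) • v 0))
        (b q.1 * rieszFactor (m • q.1 + s) * (x * rieszFactor q.2)) := fun s =>
      Continuous.indepMoment hp0 M _ (by fun_prop) (by fun_prop)
    have hrw : ∀ s : 𝕋, ∫ t, indepMoment p (M + 1) v (a t + (b t * rieszFactor (m • t + s)) • w)
        (b t * rieszFactor (m • t + s) * x) ∂𝔪 =
        ∫ ψ, ∫ t, indepMoment p M (fun k => v (k + 1))
          (a t + (b t * rieszFactor (m • t + s)) • (w + (x * rieszFactor ψ) • v 0))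
          (b t * rieszFactor (m • t + s) * (x * rieszFactor ψ)) ∂𝔪 ∂𝔪 := by
      intro s
      rw [← integral_circle_swap (hcont s)]
      simp only [indepMoment_succ]
      congr 1
      ext t
      congr 1
      ext ψ
      congr 1
      · module
      · ring
    have hint : ∀ s : 𝕋, Continuous fun ψ => ∫ t, indepMoment p M (fun k => v (k + 1))
          (a t + (b t * rieszFactor (m • t + s)) • (w + (x * rieszFactor ψ) • v 0))
          (b t * rieszFactor (m • t + s) * (x * rieszFactor ψ)) ∂𝔪 := fun s =>
      continuous_integral_circle ((hcont s).comp continuous_swap)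
    rw [hrw, hrw, ← integral_const_mul]
    exact integral_mono ((hint s).integrable_circle.const_mul _) (hint s').integrable_circle
      fun ψ => ih _ _ _

/-- Comparison of an independent next factor with the factor of frequency `m`, both ways. -/
theorem integral_indepMoment_transfer {p : ℝ} (hp : 1 ≤ p) {m : ℕ} (hm : 0 < m) {d δ : ℝ}
    (hδ : 0 < δ) (hd : d ≤ δ * m) (hδ1 : 0 ≤ 1 - 2 * Real.pi ^ 2 * δ ^ 2) {a : C(𝕋, E)}
    (ha : a ∈ trigPoly E d) {b : C(𝕋, ℝ)} (hb : b ∈ trigPoly ℝ d) (M : ℕ) (v : ℕ → E) :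
    (1 - 2 * Real.pi ^ 2 * δ ^ 2) ^ p * (∫ t, indepMoment p (M + 1) v (a t) (b t) ∂𝔪) ≤
      ∫ t, indepMoment p M (fun k => v (k + 1)) (a t + (b t * rieszFactor (m • t)) • v 0)
        (b t * rieszFactor (m • t)) ∂𝔪 ∧
    (1 - 2 * Real.pi ^ 2 * δ ^ 2) ^ p *
      (∫ t, indepMoment p M (fun k => v (k + 1)) (a t + (b t * rieszFactor (m • t)) • v 0)
        (b t * rieszFactor (m • t)) ∂𝔪) ≤ ∫ t, indepMoment p (M + 1) v (a t) (b t) ∂𝔪 := by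
  have hp0 : 0 ≤ p := by linarith
  have hX := continuous_rieszFactor
  have hcont : Continuous fun q : 𝕋 × 𝕋 => indepMoment p M (fun k => v (k + 1))
      (a q.1 + (b q.1 * rieszFactor (m • q.1 + q.2)) • v 0)
      (b q.1 * rieszFactor (m • q.1 + q.2)) :=
    Continuous.indepMoment hp0 M _ (by fun_prop) (by fun_prop)
  have havg : ∫ t, indepMoment p (M + 1) v (a t) (b t) ∂𝔪 =
      ∫ s, ∫ t, indepMoment p M (fun k => v (k + 1))
        (a t + (b t * rieszFactor (m • t + s)) • v 0)
        (b t * rieszFactor (m • t + s)) ∂𝔪 ∂𝔪 := by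
    rw [← integral_circle_swap hcont]
    simp only [indepMoment_succ]
    congr 1
    ext t
    exact (integral_add_left_eq_self (fun s => indepMoment p M (fun k => v (k + 1))
      (a t + (b t * rieszFactor s) • v 0) (b t * rieszFactor s)) (m • t)).symm
  have hint : Continuous fun s => ∫ t, indepMoment p M (fun k => v (k + 1))
        (a t + (b t * rieszFactor (m • t + s)) • v 0)
        (b t * rieszFactor (m • t + s)) ∂𝔪 :=
    continuous_integral_circle (hcont.comp continuous_swap)
  have hcmp := fun s s' => integral_indepMoment_phase_le hp hm hδ hd hδ1 ha hb M
    (fun k => v (k + 1)) (v 0) 1 s s'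
  simp only [mul_one] at hcmp
  rw [havg]
  constructor
  · rw [← integral_const_mul]
    have h := integral_mono (μ := 𝔪) (hint.integrable_circle.const_mul _) (integrable_const _)
      fun s => hcmp s 0
    simpa using h
  · have h := integral_mono (μ := 𝔪) (integrable_const _) hint.integrable_circle
      fun s => hcmp 0 s
    simpa using h

/-! ### Riesz products as trigonometric polynomials -/

theorem rieszProduct_zero (n : ℕ → ℕ) (t : 𝕋) : rieszProduct n 0 t = 1 := by
  simp [rieszProduct]

theorem rieszProduct_succ (n : ℕ → ℕ) (k : ℕ) (t : 𝕋) :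
    rieszProduct n (k + 1) t = rieszProduct n k t * rieszFactor (n (k + 1) • t) := by
  simp [rieszProduct, Finset.prod_Icc_succ_top, rieszFactor]

/-- The Riesz product as a continuous function. -/
noncomputable def rieszMap (n : ℕ → ℕ) (k : ℕ) : C(𝕋, ℝ) :=
  ⟨rieszProduct n k, by
    have := continuous_torusCos
    unfold rieszProduct
    fun_prop⟩

theorem rieszMap_apply (n : ℕ → ℕ) (k : ℕ) (t : 𝕋) : rieszMap n k t = rieszProduct n k t := rfl

theorem rieszMap_zero (n : ℕ → ℕ) : rieszMap n 0 = 1 := by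
  ext t; exact rieszProduct_zero n t

theorem rieszMap_succ (n : ℕ → ℕ) (k : ℕ) :
    rieszMap n (k + 1) = rieszMap n k * rieszFactorMap (n (k + 1)) := by
  ext t; exact rieszProduct_succ n k t

theorem rieszMap_nonneg (n : ℕ → ℕ) (k : ℕ) (t : 𝕋) : 0 ≤ rieszMap n k t := by
  rw [rieszMap_apply]
  exact Finset.prod_nonneg fun _ _ => rieszFactor_nonneg _

theorem rieszMap_le (n : ℕ → ℕ) (k : ℕ) (t : 𝕋) : rieszMap n k t ≤ 2 ^ k := by
  have : rieszProduct n k t ≤ ∏ _j ∈ Finset.Icc 1 k, (2 : ℝ) :=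
    Finset.prod_le_prod (fun _ _ => rieszFactor_nonneg _) fun _ _ => rieszFactor_le_two _
  simpa [rieszMap_apply] using this

/-- The degree `n 1 + ⋯ + n k` of the `k`-th Riesz product. -/
noncomputable def rieszDegree (n : ℕ → ℕ) (k : ℕ) : ℝ := ∑ i ∈ Finset.Icc 1 k, (n i : ℝ)

theorem rieszDegree_succ (n : ℕ → ℕ) (k : ℕ) :
    rieszDegree n (k + 1) = rieszDegree n k + n (k + 1) := by
  simp [rieszDegree, Finset.sum_Icc_succ_top]

theorem rieszDegree_mono (n : ℕ → ℕ) : Monotone (rieszDegree n) :=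
  monotone_nat_of_le_succ fun k => by
    rw [rieszDegree_succ]
    exact le_add_of_nonneg_right (Nat.cast_nonneg _)

theorem rieszMap_mem_trigPoly (n : ℕ → ℕ) (k : ℕ) :
    rieszMap n k ∈ trigPoly ℝ (rieszDegree n k) := by
  induction k with
  | zero =>
    rw [rieszMap_zero]
    exact one_mem_trigPoly (by simp [rieszDegree])
  | succ k ih =>
    rw [rieszMap_succ, rieszDegree_succ]
    exact mul_rieszFactorMap_mem ih _

/-- The combination `∑_{i ≤ k} R_i • v i`. -/
noncomputable def rieszSum (n : ℕ → ℕ) (v : ℕ → E) (k : ℕ) : C(𝕋, E) :=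
  ∑ i ∈ Finset.range (k + 1), ContinuousMap.smulVec (v i) (rieszMap n i)

theorem rieszSum_apply (n : ℕ → ℕ) (v : ℕ → E) (k : ℕ) (t : 𝕋) :
    rieszSum n v k t = ∑ i ∈ Finset.range (k + 1), rieszMap n i t • v i := by
  simp [rieszSum, smulVec_apply]

theorem rieszSum_mem_trigPoly (n : ℕ → ℕ) (v : ℕ → E) (k : ℕ) :
    rieszSum n v k ∈ trigPoly E (rieszDegree n k) := by
  refine Submodule.sum_mem _ fun i hi => smulVec_mem_trigPoly ?_ _
  exact trigPoly_mono (rieszDegree_mono n (by simpa [Nat.lt_succ_iff] using hi))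
    (rieszMap_mem_trigPoly n i)

theorem rieszSum_succ_apply (n : ℕ → ℕ) (v : ℕ → E) (k : ℕ) (t : 𝕋) :
    rieszSum n v (k + 1) t =
      rieszSum n v k t + (rieszMap n k t * rieszFactor (n (k + 1) • t)) • v (k + 1) := by
  rw [rieszSum_apply, Finset.sum_range_succ, ← rieszSum_apply, rieszMap_apply n (k + 1),
    rieszProduct_succ, rieszMap_apply]

/-! ### Linear independence of the Riesz products -/

theorem two_mul_rieszDegree_le {n : ℕ → ℕ} (hthree : ∀ j : ℕ, 1 ≤ j → 3 * n j ≤ n (j + 1))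
    {j : ℕ} (hj : 1 ≤ j) : 2 * rieszDegree n j ≤ 3 * n j := by
  induction j, hj using Nat.le_induction with
  | base => simp [rieszDegree]; linarith [(n 1).cast_nonneg (α := ℝ)]
  | succ j hj ih =>
    have h : (3 * n j : ℝ) ≤ n (j + 1) := by exact_mod_cast hthree j hj
    rw [rieszDegree_succ]
    linarith

theorem two_mul_rieszDegree_le_succ {n : ℕ → ℕ} (hthree : ∀ j : ℕ, 1 ≤ j → 3 * n j ≤ n (j + 1))
    (j : ℕ) : 2 * rieszDegree n j ≤ n (j + 1) := by
  rcases Nat.eq_zero_or_pos j with rfl | hj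
  · simp [rieszDegree]
  · have h : (3 * n j : ℝ) ≤ n (j + 1) := by exact_mod_cast hthree j hj
    exact (two_mul_rieszDegree_le hthree hj).trans h

theorem frequency_mono {n : ℕ → ℕ} (hthree : ∀ j : ℕ, 1 ≤ j → 3 * n j ≤ n (j + 1))
    {j k : ℕ} (hj : 1 ≤ j) (hjk : j ≤ k) : n j ≤ n k := by
  induction k, hjk using Nat.le_induction with
  | base => exact le_rfl
  | succ k hk ih => have := hthree k (hj.trans hk); omega

theorem torusCos_nsmul_mul {a b : ℕ} (h : b ≤ a) (t : 𝕋) :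
    torusCos (a • t) * torusCos (b • t) =
      (torusCos ((a + b) • t) + torusCos ((a - b) • t)) / 2 := by
  rw [torusCos_mul, add_smul, sub_nsmul _ h, sub_eq_add_neg]

theorem integral_mul_torusCos_mul_torusCos {d : ℝ} {f : C(𝕋, ℝ)} (hf : f ∈ trigPoly ℝ d)
    {a b : ℕ} (hba : b ≤ a) (hab : d + b < a) :
    ∫ t, f t * (torusCos (a • t) * torusCos (b • t)) ∂𝔪 = 0 := by
  have hT := continuous_torusCos
  have h1 : ∀ t, f t * (torusCos (a • t) * torusCos (b • t)) =
      (f t * torusCos ((a + b) • t) + f t * torusCos ((a - b) • t)) * (1 / 2) := by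
    intro t
    rw [torusCos_nsmul_mul hba]
    ring
  have hb : (0 : ℝ) ≤ b := b.cast_nonneg
  simp_rw [h1]
  rw [integral_mul_const, integral_add (Continuous.integrable_circle (by fun_prop))
    (Continuous.integrable_circle (by fun_prop)), integral_mul_torusCos_eq_zero hf
    (by push_cast; linarith), integral_mul_torusCos_eq_zero hf
    (by rw [Nat.cast_sub hba]; linarith)]
  simp

theorem integral_rieszMap {n : ℕ → ℕ} (hpos : ∀ j : ℕ, 1 ≤ j → 0 < n j)
    (hthree : ∀ j : ℕ, 1 ≤ j → 3 * n j ≤ n (j + 1)) (i : ℕ) : ∫ t, rieszMap n i t ∂𝔪 = 1 := by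
  induction i with
  | zero => simp [rieszMap_zero]
  | succ i ih =>
    have hT := continuous_torusCos
    have hn : (0 : ℝ) < n (i + 1) := by exact_mod_cast hpos (i + 1) (by omega)
    have hd := two_mul_rieszDegree_le_succ hthree i
    have h1 : ∀ t, rieszMap n (i + 1) t =
        rieszMap n i t + rieszMap n i t * torusCos (n (i + 1) • t) := by
      intro t
      rw [rieszMap_apply, rieszProduct_succ, rieszFactor, rieszMap_apply]
      ring
    simp_rw [h1]
    rw [integral_add (Continuous.integrable_circle (by fun_prop))
      (Continuous.integrable_circle (by fun_prop)), ih,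
      integral_mul_torusCos_eq_zero (rieszMap_mem_trigPoly n i) (by linarith), add_zero]

/-- The coefficient of `cos (n k t)` in the `i`-th Riesz product. -/
theorem integral_rieszMap_mul_torusCos {n : ℕ → ℕ} (hpos : ∀ j : ℕ, 1 ≤ j → 0 < n j)
    (hthree : ∀ j : ℕ, 1 ≤ j → 3 * n j ≤ n (j + 1)) (i : ℕ) {k : ℕ} (hk : 1 ≤ k) :
    ∫ t, rieszMap n i t * torusCos (n k • t) ∂𝔪 = if k ≤ i then 1 / 2 else 0 := by
  have hT := continuous_torusCos
  have hsmall : ∀ i < k, ∫ t, rieszMap n i t * torusCos (n k • t) ∂𝔪 = 0 := by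
    intro i hi
    refine integral_mul_torusCos_eq_zero (rieszMap_mem_trigPoly n i) ?_
    have h1 := two_mul_rieszDegree_le_succ hthree i
    have h2 : (n (i + 1) : ℝ) ≤ n k := by exact_mod_cast frequency_mono hthree (by omega) hi
    have h3 : (0 : ℝ) < n k := by exact_mod_cast hpos k hk
    linarith
  have hsucc : ∀ i, ∫ t, rieszMap n (i + 1) t * torusCos (n k • t) ∂𝔪 =
      ∫ t, rieszMap n i t * torusCos (n k • t) ∂𝔪 +
        ∫ t, rieszMap n i t * (torusCos (n (i + 1) • t) * torusCos (n k • t)) ∂𝔪 := by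
    intro i
    rw [← integral_add (Continuous.integrable_circle (by fun_prop))
      (Continuous.integrable_circle (by fun_prop))]
    congr 1
    ext t
    rw [rieszMap_apply, rieszProduct_succ, rieszFactor, rieszMap_apply]
    ring
  induction i with
  | zero => rw [hsmall 0 (by omega), if_neg (by omega)]
  | succ i ih =>
    rcases lt_trichotomy k (i + 1) with h | h | h
    · have h1 : (3 * n i : ℝ) ≤ n (i + 1) := by exact_mod_cast hthree i (by omega)
      have h2 : (n k : ℝ) ≤ n i := by exact_mod_cast frequency_mono hthree hk (by omega)
      have h3 := two_mul_rieszDegree_le hthree (j := i) (by omega)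
      have h4 : (0 : ℝ) < n k := by exact_mod_cast hpos k hk
      rw [hsucc, ih, integral_mul_torusCos_mul_torusCos (rieszMap_mem_trigPoly n i)
        (frequency_mono hthree hk h.le) (by linarith), if_pos (by omega), if_pos h.le, add_zero]
    · subst h
      have h1 : ∀ t, rieszMap n i t * (torusCos (n (i + 1) • t) * torusCos (n (i + 1) • t)) =
          (rieszMap n i t * torusCos ((n (i + 1) + n (i + 1)) • t) + rieszMap n i t) * (1 / 2) := by
        intro t
        rw [torusCos_nsmul_mul le_rfl, Nat.sub_self, zero_smul,
          show torusCos 0 = 1 from Real.cos_zero]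
        ring
      have h2 := two_mul_rieszDegree_le_succ hthree i
      have h3 : (0 : ℝ) < n (i + 1) := by exact_mod_cast hpos (i + 1) hk
      rw [hsucc, hsmall i (by omega), if_pos le_rfl]
      simp_rw [h1]
      rw [integral_mul_const, integral_add (Continuous.integrable_circle (by fun_prop))
        (Continuous.integrable_circle (by fun_prop)), integral_rieszMap hpos hthree,
        integral_mul_torusCos_eq_zero (rieszMap_mem_trigPoly n i) (by push_cast; linarith)]
      norm_num
    · rw [hsmall (i + 1) h, if_neg (by omega)]

/-- Differences of consecutive test functions `1, 2 cos (n 1 t), 2 cos (n 2 t), …` are biorthogonal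
to the Riesz products. -/
theorem exists_biorthogonal {n : ℕ → ℕ} (hpos : ∀ j : ℕ, 1 ≤ j → 0 < n j)
    (hthree : ∀ j : ℕ, 1 ≤ j → 3 * n j ≤ n (j + 1)) (k : ℕ) :
    ∃ ψ : C(𝕋, ℝ), (∀ t, |ψ t| ≤ 4) ∧
      ∀ i, ∫ t, rieszMap n i t * ψ t ∂𝔪 = if i = k then 1 else 0 := by
  have hT := continuous_torusCos
  have htest : ∀ k, ∃ e : C(𝕋, ℝ), (∀ t, |e t| ≤ 2) ∧
      ∀ i, ∫ t, rieszMap n i t * e t ∂𝔪 = if k ≤ i then 1 else 0 := by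
    intro k
    rcases Nat.eq_zero_or_pos k with rfl | hk
    · exact ⟨1, fun t => by simp, fun i => by simp [integral_rieszMap hpos hthree]⟩
    · refine ⟨⟨fun t => 2 * torusCos (n k • t), by fun_prop⟩, fun t => ?_, fun i => ?_⟩
      · have := abs_torusCos_le_one (n k • t)
        rw [ContinuousMap.coe_mk, abs_mul, abs_two]
        linarith
      · simp only [ContinuousMap.coe_mk, mul_left_comm _ (2 : ℝ)]
        rw [integral_const_mul, integral_rieszMap_mul_torusCos hpos hthree i hk]
        split_ifs <;> norm_num
  obtain ⟨e, he, he'⟩ := htest k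
  obtain ⟨g, hg, hg'⟩ := htest (k + 1)
  refine ⟨e - g, fun t => ?_, fun i => ?_⟩
  · have := abs_sub (e t) (g t)
    have := he t
    have := hg t
    rw [ContinuousMap.sub_apply]
    linarith
  · simp only [ContinuousMap.sub_apply, mul_sub]
    rw [integral_sub (Continuous.integrable_circle (by fun_prop))
      (Continuous.integrable_circle (by fun_prop)), he', hg']
    split_ifs <;> first | omega | norm_num

theorem rpow_integral_le_integral_rpow {p : ℝ} (hp : 1 ≤ p) {f : 𝕋 → ℝ} (hf : Continuous f)
    (h0 : ∀ t, 0 ≤ f t) : (∫ t, f t ∂𝔪) ^ p ≤ ∫ t, f t ^ p ∂𝔪 :=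
  (convexOn_rpow hp).map_integral_le
    (Real.continuous_rpow_const (by linarith)).continuousOn isClosed_Ici
    (Filter.Eventually.of_forall h0) hf.integrable_circle
    (Continuous.integrable_circle (hf.rpow_const fun _ => Or.inr (by linarith)))

theorem norm_coeff_le {n : ℕ → ℕ} (hpos : ∀ j : ℕ, 1 ≤ j → 0 < n j)
    (hthree : ∀ j : ℕ, 1 ≤ j → 3 * n j ≤ n (j + 1)) (v : ℕ → E) {J k : ℕ} (hk : k ≤ J) :
    ‖v k‖ ≤ 4 * ∫ t, ‖rieszSum n v J t‖ ∂𝔪 := by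
  obtain ⟨g, hg, hgv⟩ := exists_dual_vector'' ℝ (v k)
  obtain ⟨ψ, hψ, hψR⟩ := exists_biorthogonal hpos hthree k
  have h1 : ∫ t, g (rieszSum n v J t) * ψ t ∂𝔪 = ‖v k‖ := by
    have h2 : ∀ t, g (rieszSum n v J t) * ψ t =
        ∑ i ∈ Finset.range (J + 1), rieszMap n i t * ψ t * g (v i) := by
      intro t
      rw [rieszSum_apply, map_sum, Finset.sum_mul]
      refine Finset.sum_congr rfl fun i _ => ?_
      rw [map_smul, smul_eq_mul]; ring
    simp_rw [h2]
    rw [integral_finsetSum _ fun i _ => Continuous.integrable_circle (by fun_prop)]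
    simp_rw [integral_mul_const, hψR]
    rw [Finset.sum_eq_single k (fun i _ hi => by simp [hi])
      (fun h => absurd (Finset.mem_range.2 (by omega)) h)]
    simpa using hgv
  rw [← h1, ← integral_const_mul]
  refine integral_mono (Continuous.integrable_circle (by fun_prop))
    (Continuous.integrable_circle (by fun_prop)) fun t => ?_
  have h3 : |g (rieszSum n v J t)| ≤ ‖rieszSum n v J t‖ := by
    simpa using g.le_of_opNorm_le hg (rieszSum n v J t)
  calc g (rieszSum n v J t) * ψ t ≤ |g (rieszSum n v J t)| * |ψ t| := by
        rw [← abs_mul]; exact le_abs_self _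
    _ ≤ ‖rieszSum n v J t‖ * 4 := by gcongr; exact hψ t
    _ = 4 * ‖rieszSum n v J t‖ := mul_comm _ _

/-- Finitely many Riesz products satisfy the two-sided estimate with constants that may depend on
their number. -/
theorem exists_initial_bounds {n : ℕ → ℕ} (hpos : ∀ j : ℕ, 1 ≤ j → 0 < n j)
    (hthree : ∀ j : ℕ, 1 ≤ j → 3 * n j ≤ n (j + 1)) {p : ℝ} (hp : 1 ≤ p) (J : ℕ) :
    ∃ c C : ℝ, 0 < c ∧ 0 < C ∧ ∀ (E : Type u) [NormedAddCommGroup E] [NormedSpace ℝ E]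
      (v : ℕ → E),
      c * ∑ k ∈ Finset.range (J + 1), factorMoment p ^ k * ‖v k‖ ^ p
        ≤ ∫ t, ‖rieszSum n v J t‖ ^ p ∂𝔪 ∧
      ∫ t, ‖rieszSum n v J t‖ ^ p ∂𝔪
        ≤ C * ∑ k ∈ Finset.range (J + 1), factorMoment p ^ k * ‖v k‖ ^ p := by
  have hA1 := one_le_factorMoment hp
  have hA := factorMoment_pos hp
  refine ⟨((J + 1 : ℕ) * (factorMoment p ^ J * 4 ^ p))⁻¹, ((J + 1 : ℕ) : ℝ) ^ (p - 1) * (2 ^ J) ^ p,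
    by positivity, by positivity, fun E _ _ v => ⟨?_, ?_⟩⟩
  · rw [inv_mul_le_iff₀ (by positivity)]
    have h1 : ∀ k ∈ Finset.range (J + 1), factorMoment p ^ k * ‖v k‖ ^ p ≤
        factorMoment p ^ J * 4 ^ p * ∫ t, ‖rieszSum n v J t‖ ^ p ∂𝔪 := by
      intro k hk
      have hkJ : k ≤ J := by simpa [Nat.lt_succ_iff] using hk
      have hi : 0 ≤ ∫ t, ‖rieszSum n v J t‖ ∂𝔪 := integral_nonneg fun t => norm_nonneg _
      have h2 := Real.rpow_le_rpow (norm_nonneg _) (norm_coeff_le hpos hthree v hkJ)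
        (by linarith : 0 ≤ p)
      rw [Real.mul_rpow (by norm_num) hi] at h2
      have h3 := rpow_integral_le_integral_rpow hp (f := fun t => ‖rieszSum n v J t‖)
        (by fun_prop) fun t => norm_nonneg _
      calc factorMoment p ^ k * ‖v k‖ ^ p
          ≤ factorMoment p ^ J * (4 ^ p * (∫ t, ‖rieszSum n v J t‖ ∂𝔪) ^ p) := by gcongr
        _ ≤ factorMoment p ^ J * (4 ^ p * ∫ t, ‖rieszSum n v J t‖ ^ p ∂𝔪) := by gcongr
        _ = _ := by ring
    have h2 := Finset.sum_le_card_nsmul _ _ _ h1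
    rw [Finset.card_range, nsmul_eq_mul] at h2
    linarith
  · have h1 : ∀ t, ‖rieszSum n v J t‖ ^ p ≤ ((J + 1 : ℕ) : ℝ) ^ (p - 1) * (2 ^ J) ^ p *
        ∑ k ∈ Finset.range (J + 1), factorMoment p ^ k * ‖v k‖ ^ p := by
      intro t
      have h2 : ‖rieszSum n v J t‖ ≤ ∑ k ∈ Finset.range (J + 1), 2 ^ J * ‖v k‖ := by
        rw [rieszSum_apply]
        refine norm_sum_le_of_le _ fun k hk => ?_
        have hkJ : k ≤ J := by simpa [Nat.lt_succ_iff] using hk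
        rw [norm_smul, Real.norm_of_nonneg (rieszMap_nonneg n k t)]
        gcongr
        exact (rieszMap_le n k t).trans (pow_le_pow_right₀ one_le_two hkJ)
      refine (Real.rpow_le_rpow (norm_nonneg _) h2 (by linarith)).trans ?_
      refine (Real.rpow_sum_le_const_mul_sum_rpow_of_nonneg _ hp fun k _ => by positivity).trans ?_
      rw [Finset.card_range, mul_assoc]
      refine mul_le_mul_of_nonneg_left ?_ (by positivity)
      rw [Finset.mul_sum]
      refine Finset.sum_le_sum fun k _ => ?_
      rw [Real.mul_rpow (by positivity) (norm_nonneg _)]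
      gcongr
      exact le_mul_of_one_le_left (by positivity) (one_le_pow₀ hA1)
    have h2 := integral_mono (μ := 𝔪) (Continuous.integrable_circle
      (Continuous.rpow_const (by fun_prop) fun _ => Or.inr (by linarith)))
      (integrable_const _) h1
    simpa using h2

/-! ### Passing from the independent model to the circle -/

/-- The hybrid moment: the first `j` factors are `1 + cos (n i t)` on the circle, the next `M` are
independent. -/
noncomputable def hybridMoment (n : ℕ → ℕ) (p : ℝ) (v : ℕ → E) (j M : ℕ) : ℝ :=
  ∫ t, indepMoment p M (fun l => v (j + 1 + l)) (rieszSum n v j t) (rieszMap n j t) ∂𝔪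

theorem hybridMoment_zero (n : ℕ → ℕ) (p : ℝ) (v : ℕ → E) (j : ℕ) :
    hybridMoment n p v j 0 = ∫ t, ‖rieszSum n v j t‖ ^ p ∂𝔪 := rfl

theorem exp_neg_two_mul_le_one_sub {x : ℝ} (h0 : 0 ≤ x) (h1 : x ≤ 1 / 2) :
    Real.exp (-(2 * x)) ≤ 1 - x := by
  rw [Real.exp_neg]
  refine inv_le_of_inv_le₀ (by linarith) ?_
  rw [inv_le_iff_one_le_mul₀ (by linarith)]
  have h2 := Real.add_one_le_exp (2 * x)
  have h3 := mul_le_mul_of_nonneg_right h2 (by linarith : 0 ≤ 1 - x)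
  nlinarith

/-- Making one more factor independent costs only a factor `1 + O((n j / n (j + 1)) ^ 2)`. -/
theorem hybridMoment_step {n : ℕ → ℕ} (hpos : ∀ j : ℕ, 1 ≤ j → 0 < n j)
    (hthree : ∀ j : ℕ, 1 ≤ j → 3 * n j ≤ n (j + 1)) {p : ℝ} (hp : 1 ≤ p) (v : ℕ → E) {j : ℕ}
    (hj : 1 ≤ j) (hq : ((n j : ℝ) / n (j + 1)) ^ 2 ≤ 1 / 90) (M : ℕ) :
    Real.exp (-(90 * p * ((n j : ℝ) / n (j + 1)) ^ 2)) * hybridMoment n p v j (M + 1) ≤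
      hybridMoment n p v (j + 1) M ∧
    Real.exp (-(90 * p * ((n j : ℝ) / n (j + 1)) ^ 2)) * hybridMoment n p v (j + 1) M ≤
      hybridMoment n p v j (M + 1) := by
  have hnj : (0 : ℝ) < n j := by exact_mod_cast hpos j hj
  have hnj1 : (0 : ℝ) < n (j + 1) := by exact_mod_cast hpos (j + 1) (by omega)
  set q := (n j : ℝ) / n (j + 1) with hqd
  have hq0 : 0 < q := by positivity
  have hδ : rieszDegree n j ≤ 3 / 2 * q * (n (j + 1) : ℕ) := by
    have h1 := two_mul_rieszDegree_le hthree hj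
    rw [mul_assoc, hqd, div_mul_cancel₀ _ hnj1.ne']
    linarith
  have hπ : Real.pi ^ 2 ≤ 10 := by
    have h1 := Real.pi_lt_d2
    have h2 := Real.pi_pos
    nlinarith
  have hx : 2 * Real.pi ^ 2 * (3 / 2 * q) ^ 2 ≤ 45 * q ^ 2 := by
    have := mul_le_mul_of_nonneg_right hπ (sq_nonneg q)
    linarith
  have hexp : Real.exp (-(90 * q ^ 2)) ≤ 1 - 2 * Real.pi ^ 2 * (3 / 2 * q) ^ 2 := by
    have := exp_neg_two_mul_le_one_sub (x := 45 * q ^ 2) (by positivity) (by linarith)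
    rw [← mul_assoc] at this
    norm_num at this
    linarith
  have hexp' : Real.exp (-(90 * p * q ^ 2)) ≤ (1 - 2 * Real.pi ^ 2 * (3 / 2 * q) ^ 2) ^ p := by
    have h1 := Real.rpow_le_rpow (Real.exp_pos _).le hexp (by linarith : 0 ≤ p)
    rw [← Real.exp_mul] at h1
    convert h1 using 2
    ring
  have ht := integral_indepMoment_transfer hp (hpos (j + 1) (by omega))
    (by positivity : 0 < 3 / 2 * q) hδ ((Real.exp_pos _).le.trans hexp)
    (rieszSum_mem_trigPoly n v j) (rieszMap_mem_trigPoly n j) M (fun l => v (j + 1 + l))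
  have hnext : hybridMoment n p v (j + 1) M = ∫ t, indepMoment p M (fun k => v (j + 1 + (k + 1)))
      (rieszSum n v j t + (rieszMap n j t * rieszFactor (n (j + 1) • t)) • v (j + 1 + 0))
      (rieszMap n j t * rieszFactor (n (j + 1) • t)) ∂𝔪 := by
    unfold hybridMoment
    congr 1
    ext t
    rw [rieszSum_succ_apply, rieszMap_apply n (j + 1), rieszProduct_succ, rieszMap_apply]
    congr 1
    ext l
    congr 1
    omega
  rw [← hnext] at ht
  have hn0 : ∀ j M, 0 ≤ hybridMoment n p v j M := fun j M =>
    integral_nonneg fun t => indepMoment_nonneg _ _ _ _ _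
  exact ⟨(mul_le_mul_of_nonneg_right hexp' (hn0 _ _)).trans ht.1,
    (mul_le_mul_of_nonneg_right hexp' (hn0 _ _)).trans ht.2⟩

theorem hybridMoment_chain {n : ℕ → ℕ} (hpos : ∀ j : ℕ, 1 ≤ j → 0 < n j)
    (hthree : ∀ j : ℕ, 1 ≤ j → 3 * n j ≤ n (j + 1)) {p : ℝ} (hp : 1 ≤ p) (v : ℕ → E) {J : ℕ}
    (hJ : 1 ≤ J) (hq : ∀ j, J ≤ j → ((n j : ℝ) / n (j + 1)) ^ 2 ≤ 1 / 90) (i M : ℕ) :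
    Real.exp (-(90 * p * ∑ l ∈ Finset.range i, ((n (J + l) : ℝ) / n (J + l + 1)) ^ 2)) *
      hybridMoment n p v J (M + i) ≤ hybridMoment n p v (J + i) M ∧
    Real.exp (-(90 * p * ∑ l ∈ Finset.range i, ((n (J + l) : ℝ) / n (J + l + 1)) ^ 2)) *
      hybridMoment n p v (J + i) M ≤ hybridMoment n p v J (M + i) := by
  induction i generalizing M with
  | zero => simp
  | succ i ih =>
    have h1 := ih (M + 1)
    have h2 := hybridMoment_step hpos hthree hp v (j := J + i) (by omega) (hq _ (by omega)) M
    rw [show M + 1 + i = M + (i + 1) by omega] at h1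
    rw [Finset.sum_range_succ, mul_add, neg_add, Real.exp_add, ← add_assoc J i 1]
    have e1 := (Real.exp_pos (-(90 * p * ((n (J + i) : ℝ) / n (J + i + 1)) ^ 2))).le
    have e2 := (Real.exp_pos (-(90 * p *
      ∑ l ∈ Finset.range i, ((n (J + l) : ℝ) / n (J + l + 1)) ^ 2))).le
    constructor
    · have h3 := mul_le_mul_of_nonneg_left h1.1 e1
      rw [mul_comm (Real.exp _) (Real.exp _), mul_assoc]
      exact h3.trans h2.1
    · have h3 := mul_le_mul_of_nonneg_left h2.2 e2
      rw [mul_assoc]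
      exact h3.trans h1.2

/-- The hybrid moment with `J` factors on the circle and `M` independent ones is comparable with the
weighted sum of the `‖v k‖ ^ p`. -/
theorem exists_hybridMoment_bounds {n : ℕ → ℕ} (hpos : ∀ j : ℕ, 1 ≤ j → 0 < n j)
    (hthree : ∀ j : ℕ, 1 ≤ j → 3 * n j ≤ n (j + 1)) {p : ℝ} (hp : 1 ≤ p) (J : ℕ) :
    ∃ c C : ℝ, 0 < c ∧ 0 < C ∧ ∀ (E : Type u) [NormedAddCommGroup E] [NormedSpace ℝ E]
      (v : ℕ → E) (M : ℕ),
      c * ∑ k ∈ Finset.range (J + M + 1), factorMoment p ^ k * ‖v k‖ ^ p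
        ≤ hybridMoment n p v J M ∧
      hybridMoment n p v J M
        ≤ C * ∑ k ∈ Finset.range (J + M + 1), factorMoment p ^ k * ‖v k‖ ^ p := by
  obtain ⟨c₁, hc₁, hlow⟩ := exists_indepMoment_lower.{u} hp
  obtain ⟨C₁, hC₁, hup⟩ := exists_indepMoment_upper.{u} hp
  obtain ⟨c₂, C₂, hc₂, hC₂, hinit⟩ := exists_initial_bounds.{u} hpos hthree hp J
  have hp0 : 0 ≤ p := by linarith
  have hA := factorMoment_pos hp
  have hRc : Continuous fun t => rieszMap n J t ^ p :=
    Continuous.rpow_const (by fun_prop) fun _ => Or.inr hp0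
  obtain ⟨ρ, hρ⟩ : ∃ ρ, ρ = ∫ t, rieszMap n J t ^ p ∂𝔪 := ⟨_, rfl⟩
  have hρ0 : 0 < ρ := by
    rw [hρ]
    refine zero_lt_one.trans_le ?_
    have h := rpow_integral_le_integral_rpow hp (rieszMap n J).continuous (rieszMap_nonneg n J)
    rwa [integral_rieszMap hpos hthree, Real.one_rpow] at h
  -- `ρ` may depend on `J`, so it enters only as a constant relative to `A ^ J`
  obtain ⟨τ, hτ⟩ : ∃ τ, τ = ρ / factorMoment p ^ J := ⟨_, rfl⟩
  have hτ0 : 0 < τ := by rw [hτ]; positivity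
  have hτρ : τ * factorMoment p ^ J = ρ := by rw [hτ]; field_simp
  refine ⟨c₁ * min c₂ τ, C₁ * max C₂ τ, by positivity, by positivity, fun E _ _ v M => ?_⟩
  set S₁ := ∑ k ∈ Finset.range (J + 1), factorMoment p ^ k * ‖v k‖ ^ p with hS₁
  set W := ∑ l ∈ Finset.range M, weight p (fun l => v (J + 1 + l)) l with hW
  have hS₁0 : 0 ≤ S₁ := Finset.sum_nonneg fun k _ => by positivity
  have hW0 : 0 ≤ W := Finset.sum_nonneg fun l _ => weight_nonneg hp _ l
  have hsplit : ∑ k ∈ Finset.range (J + M + 1), factorMoment p ^ k * ‖v k‖ ^ p =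
      S₁ + factorMoment p ^ J * W := by
    rw [show J + M + 1 = J + 1 + M by omega, Finset.sum_range_add, hW, Finset.mul_sum]
    congr 1
    refine Finset.sum_congr rfl fun l _ => ?_
    simp only [weight]
    ring
  have hYc : Continuous fun t => ‖rieszSum n v J t‖ ^ p :=
    Continuous.rpow_const (by fun_prop) fun _ => Or.inr hp0
  have hmid : ∀ c : ℝ, ∫ t, c * (‖rieszSum n v J t‖ ^ p + rieszMap n J t ^ p * W) ∂𝔪 =
      c * ((∫ t, ‖rieszSum n v J t‖ ^ p ∂𝔪) + τ * (factorMoment p ^ J * W)) := by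
    intro c
    rw [integral_const_mul, integral_add hYc.integrable_circle
      (hRc.integrable_circle.mul_const _), integral_mul_const, ← hρ, ← mul_assoc, hτρ]
  have hci : ∀ c : ℝ, Integrable
      (fun t => c * (‖rieszSum n v J t‖ ^ p + rieszMap n J t ^ p * W)) 𝔪 := fun c =>
    (hYc.integrable_circle.add (hRc.integrable_circle.mul_const _)).const_mul c
  have hGi : Integrable (fun t => indepMoment p M (fun l => v (J + 1 + l)) (rieszSum n v J t)
      (rieszMap n J t)) 𝔪 :=
    (Continuous.indepMoment hp0 M _ (by fun_prop) (by fun_prop)).integrable_circle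
  have h1 := integral_mono (hci c₁) hGi fun t => hlow E M _ _ _ (rieszMap_nonneg n J t)
  have h2 := integral_mono hGi (hci C₁) fun t => hup E M _ _ _ (rieszMap_nonneg n J t)
  rw [hmid] at h1 h2
  have hJW : 0 ≤ factorMoment p ^ J * W := by positivity
  rw [hsplit]
  constructor
  · refine le_trans ?_ h1
    rw [mul_assoc]
    refine mul_le_mul_of_nonneg_left ?_ hc₁.le
    rw [mul_add]
    exact add_le_add ((mul_le_mul_of_nonneg_right (min_le_left _ _) hS₁0).trans (hinit E v).1)
      (mul_le_mul_of_nonneg_right (min_le_right _ _) hJW)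
  · refine h2.trans ?_
    rw [mul_assoc]
    refine mul_le_mul_of_nonneg_left ?_ hC₁.le
    rw [mul_add]
    exact add_le_add ((hinit E v).2.trans (mul_le_mul_of_nonneg_right (le_max_left _ _) hS₁0))
      (mul_le_mul_of_nonneg_right (le_max_right _ _) hJW)

/-- The two-sided estimate with the moments of `R_k` replaced by those of a product of `k`
independent factors. -/
theorem exists_rieszSum_bounds {n : ℕ → ℕ} (hpos : ∀ j : ℕ, 1 ≤ j → 0 < n j)
    (hthree : ∀ j : ℕ, 1 ≤ j → 3 * n j ≤ n (j + 1))
    (hsum : Summable fun j : ℕ => ((n (j + 1) : ℝ) / (n (j + 2) : ℝ)) ^ 2)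
    {p : ℝ} (hp : 1 ≤ p) :
    ∃ c C : ℝ, 0 < c ∧ 0 < C ∧ ∀ (E : Type u) [NormedAddCommGroup E] [NormedSpace ℝ E]
      (v : ℕ → E) (N : ℕ),
      c * ∑ k ∈ Finset.range (N + 1), factorMoment p ^ k * ‖v k‖ ^ p
        ≤ ∫ t, ‖rieszSum n v N t‖ ^ p ∂𝔪 ∧
      ∫ t, ‖rieszSum n v N t‖ ^ p ∂𝔪
        ≤ C * ∑ k ∈ Finset.range (N + 1), factorMoment p ^ k * ‖v k‖ ^ p := by
  obtain ⟨J, hJ⟩ := Filter.eventually_atTop.1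
    (hsum.tendsto_atTop_zero.eventually_le_const (by norm_num : (0 : ℝ) < 1 / 90))
  have hq : ∀ j, J + 1 ≤ j → ((n j : ℝ) / n (j + 1)) ^ 2 ≤ 1 / 90 := by
    intro j hj
    obtain ⟨i, rfl⟩ : ∃ i, j = i + 1 := ⟨j - 1, by omega⟩
    exact hJ i (by omega)
  obtain ⟨c, C, hc, hC, hb⟩ := exists_hybridMoment_bounds.{u} hpos hthree hp (J + 1)
  have hsum' := (summable_nat_add_iff J).2 hsum
  obtain ⟨σ, hσ⟩ : ∃ σ, σ = ∑' l, ((n (l + J + 1) : ℝ) / (n (l + J + 2) : ℝ)) ^ 2 := ⟨_, rfl⟩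
  obtain ⟨κ, hκ⟩ : ∃ κ, κ = Real.exp (-(90 * p * σ)) := ⟨_, rfl⟩
  have hκ0 : 0 < κ := by rw [hκ]; exact Real.exp_pos _
  refine ⟨κ * c, κ⁻¹ * C, by positivity, by positivity, fun E _ _ v N => ?_⟩
  -- padding with zeros makes the number of terms exceed `J + 1`
  obtain ⟨u, hu⟩ : ∃ u : ℕ → E, u = fun k => if k ≤ N then v k else 0 := ⟨_, rfl⟩
  have hsub : Finset.range (N + 1) ⊆ Finset.range (J + 1 + N + 1) :=
    Finset.range_subset_range.2 (by omega)
  have hT : ∑ k ∈ Finset.range (J + 1 + N + 1), factorMoment p ^ k * ‖u k‖ ^ p =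
      ∑ k ∈ Finset.range (N + 1), factorMoment p ^ k * ‖v k‖ ^ p := by
    rw [← Finset.sum_subset hsub fun k _ hk => ?_]
    · refine Finset.sum_congr rfl fun k hk => ?_
      have : k ≤ N := by simpa [Nat.lt_succ_iff] using hk
      simp [hu, this]
    · have : ¬k ≤ N := by simpa [Nat.lt_succ_iff] using hk
      simp [hu, this, Real.zero_rpow (by linarith : p ≠ 0)]
  have hY : ∀ t, rieszSum n u (J + 1 + N) t = rieszSum n v N t := by
    intro t
    rw [rieszSum_apply, rieszSum_apply, ← Finset.sum_subset hsub fun k _ hk => ?_]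
    · refine Finset.sum_congr rfl fun k hk => ?_
      have : k ≤ N := by simpa [Nat.lt_succ_iff] using hk
      simp [hu, this]
    · have : ¬k ≤ N := by simpa [Nat.lt_succ_iff] using hk
      simp [hu, this]
  have hch := hybridMoment_chain hpos hthree hp u (by omega) hq N 0
  rw [hybridMoment_zero, zero_add] at hch
  simp_rw [hY] at hch
  obtain ⟨hb1, hb2⟩ := hb E u N
  rw [hT] at hb1 hb2
  have hκle : κ ≤ Real.exp (-(90 * p *
      ∑ l ∈ Finset.range N, ((n (J + 1 + l) : ℝ) / n (J + 1 + l + 1)) ^ 2)) := by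
    rw [hκ]
    refine Real.exp_le_exp.2 (neg_le_neg (mul_le_mul_of_nonneg_left ?_ (by linarith)))
    rw [hσ]
    refine le_trans (le_of_eq ?_) (hsum'.sum_le_tsum (Finset.range N) fun l _ => sq_nonneg _)
    refine Finset.sum_congr rfl fun l _ => ?_
    rw [show J + 1 + l = l + J + 1 by omega]
  have hI0 : 0 ≤ ∫ t, ‖rieszSum n v N t‖ ^ p ∂𝔪 := integral_nonneg fun t => by positivity
  have hH0 : 0 ≤ hybridMoment n p u (J + 1) N :=
    integral_nonneg fun t => indepMoment_nonneg _ _ _ _ _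
  constructor
  · rw [mul_assoc]
    exact (mul_le_mul_of_nonneg_left hb1 hκ0.le).trans
      ((mul_le_mul_of_nonneg_right hκle hH0).trans hch.1)
  · rw [mul_assoc, ← div_eq_inv_mul, le_div_iff₀ hκ0, mul_comm]
    exact (mul_le_mul_of_nonneg_right hκle hI0).trans (hch.2.trans hb2)

theorem exists_moment_bounds {n : ℕ → ℕ} (hpos : ∀ j : ℕ, 1 ≤ j → 0 < n j)
    (hthree : ∀ j : ℕ, 1 ≤ j → 3 * n j ≤ n (j + 1))
    (hsum : Summable fun j : ℕ => ((n (j + 1) : ℝ) / (n (j + 2) : ℝ)) ^ 2)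
    {p : ℝ} (hp : 1 ≤ p) :
    ∃ c C : ℝ, 0 < c ∧ 0 < C ∧ ∀ k : ℕ,
      c * factorMoment p ^ k ≤ ∫ t, rieszMap n k t ^ p ∂𝔪 ∧
      ∫ t, rieszMap n k t ^ p ∂𝔪 ≤ C * factorMoment p ^ k := by
  obtain ⟨c, C, hc, hC, hb⟩ := exists_rieszSum_bounds.{0} hpos hthree hsum hp
  refine ⟨c, C, hc, hC, fun k => ?_⟩
  have h := hb ℝ (fun i => if i = k then 1 else 0) k
  have hp0 : p ≠ 0 := by linarith
  have h1 : ∀ t, rieszSum n (fun i => if i = k then (1 : ℝ) else 0) k t = rieszMap n k t := by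
    intro t
    rw [rieszSum_apply, Finset.sum_eq_single k (fun i _ hi => by simp [hi])
      (fun h => absurd (Finset.mem_range.2 (by omega)) h)]
    simp
  have h2 : ∑ i ∈ Finset.range (k + 1),
      factorMoment p ^ i * ‖(if i = k then (1 : ℝ) else 0)‖ ^ p = factorMoment p ^ k := by
    rw [Finset.sum_eq_single k (fun i _ hi => by simp [hi, Real.zero_rpow hp0])
      (fun h => absurd (Finset.mem_range.2 (by omega)) h)]
    simp
  rw [h2] at h
  simpa only [h1, Real.norm_of_nonneg (rieszMap_nonneg n k _)] using h

theorem mainTheorem3 (n : ℕ → ℕ) (hpos : ∀ j : ℕ, 1 ≤ j → 0 < n j)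
    (hratio : ∀ j : ℕ, 1 ≤ j → (3 : ℝ) ≤ (n (j + 1) : ℝ) / (n j : ℝ))
    (hSchneider : Summable fun j : ℕ => ((n (j + 1) : ℝ) / (n (j + 2) : ℝ)) ^ 2)
    (p : ℝ) (hp : 1 ≤ p) :
    ∃ c C : ℝ, 0 < c ∧ 0 < C ∧
      ∀ (E : Type u) [NormedAddCommGroup E] [NormedSpace ℝ E] (v : ℕ → E) (N : ℕ), 1 ≤ N →
        c * ∑ k ∈ Finset.range (N + 1), ‖v k‖ ^ p * torusMean (fun t => rieszProduct n k t ^ p)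
            ≤ torusMean
                (fun t => ‖∑ k ∈ Finset.range (N + 1), rieszProduct n k t • v k‖ ^ p) ∧
        torusMean (fun t => ‖∑ k ∈ Finset.range (N + 1), rieszProduct n k t • v k‖ ^ p)
            ≤ C * ∑ k ∈ Finset.range (N + 1),
                ‖v k‖ ^ p * torusMean (fun t => rieszProduct n k t ^ p) := by
  have hthree : ∀ j : ℕ, 1 ≤ j → 3 * n j ≤ n (j + 1) := by
    intro j hj
    have h1 : (0 : ℝ) < n j := by exact_mod_cast hpos j hj
    have h2 := (le_div_iff₀ h1).1 (hratio j hj)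
    exact_mod_cast h2
  obtain ⟨c, C, hc, hC, hb⟩ := exists_rieszSum_bounds.{u} hpos hthree hSchneider hp
  obtain ⟨c₀, C₀, hc₀, hC₀, hm⟩ := exists_moment_bounds hpos hthree hSchneider hp
  refine ⟨c / C₀, C / c₀, by positivity, by positivity, fun E _ _ v N _ => ?_⟩
  have hmean : torusMean (fun t => ‖∑ k ∈ Finset.range (N + 1), rieszProduct n k t • v k‖ ^ p) =
      ∫ t, ‖rieszSum n v N t‖ ^ p ∂𝔪 := by
    simp only [rieszSum_apply]
    rfl
  have hmom : ∀ k, torusMean (fun t => rieszProduct n k t ^ p) = ∫ t, rieszMap n k t ^ p ∂𝔪 :=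
    fun k => rfl
  simp only [hmean, hmom]
  obtain ⟨h1, h2⟩ := hb E v N
  constructor
  · refine le_trans ?_ h1
    rw [div_mul_eq_mul_div, mul_div_assoc]
    refine mul_le_mul_of_nonneg_left ?_ hc.le
    rw [div_le_iff₀ hC₀, Finset.sum_mul]
    refine Finset.sum_le_sum fun k _ => ?_
    have := mul_le_mul_of_nonneg_left (hm k).2 (by positivity : 0 ≤ ‖v k‖ ^ p)
    linarith
  · refine h2.trans ?_
    rw [div_mul_eq_mul_div, mul_div_assoc]
    refine mul_le_mul_of_nonneg_left ?_ hC.le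
    rw [le_div_iff₀ hc₀, Finset.sum_mul]
    refine Finset.sum_le_sum fun k _ => ?_
    have := mul_le_mul_of_nonneg_left (hm k).1 (by positivity : 0 ≤ ‖v k‖ ^ p)
    linarith
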